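/- Let $\mathbb{F}_q$ be a finite field, $K=\mathbb{F}_q(T)$, and let $f(x)\in\mathbb{F}_q[T][x]$ be a monic polynomial in $x$ of non-zero discriminant. For a square-free polynomial $d\in\mathbb{F}_q[T]$ let $E_d$ be the curve $dy^2=f(x)$ and let $E=E_1$ be the curve $y^2=f(x)$. To a point $P=(x,y)\in E_d(K)$ associate the point $P'=(x,d^{1/2}y)$ of $E(\overline K)$, where $d^{1/2}\in\overline K$ is either square root of $d$. Heights. For $z\in\overline{K}$ and a finite extension $L$ of $K$ containing $z$ put $H(z)=\Big(\prod_w\max(|z|_w^{n_w},1)\Big)^{1/[L:K]}$, the product being over all places $w$ of $L$, with $n_w$ the local degree at $w$, where $|\cdot|_w$ extends the absolute value $|\cdot|_v=q^{-\deg(v)\,\mathrm{ord}_v(\cdot)}$ of the place $v$ of $K$ below $w$; thus $H(z_0/z_1)=q^{\max(\deg z_0,\deg z_1)}$ for coprime $z_0,z_1\in\mathbb{F}_q[T]$, $z_1\ne 0$ (with $\deg 0=-\infty$). Put $h_x(P)=\log_q H(x(P))$ and $h_y(P)=\log_q H(y(P))$ for affine points $P$, and $h_x(\mathcal O)=h_y(\mathcal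 O)=0$ for the point at infinity $\mathcal{O}$. If $\deg f=3$ and $q$ is odd, then $E_d$ is an elliptic curve with origin $\mathcal O$ and its canonical height is $\hat h^{E_d}(P)=\frac12\lim_{n\to\infty}h_x([n]P)/n^2$; likewise for $\hat h^{E}$. Then: 1. If $\deg f=3$ and $q$ is odd, then for every square-free $d$ and every $P=(x,y)\in E_d(K)$ the limits defining $\hat h^{E_d}(P)$ and $\hat h^{E}(P')$ exist and $\hat h^{E_d}(P)=\hat h^{E}(P')$. 2. If $\deg f\ge 2$, then for every square-free $d$ and every $P=(x,y)\in E_d(K)$ with $y\neq 0$ one has $h_y(P')\ge\frac38\deg d$. 3. If $\deg f=3$ and $q$ is odd, then there is a real constant $c_f$ depending only on $f$ (and the field $\mathbb{F}_q$) such that for every square-free $d$ and every $P=(x,y)\in E_d(K)$ with $y\neq0$ one has $\hat h^{E_d}(P)\ge\frac18\deg d+c_f$. -/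

import Mathlib

open Polynomial Filter Topology
open scoped WithZero

noncomputable section

/-! ### Heights of algebraic functions -/

/-- A place of a field `L`, given by its normalized discrete valuation: a surjective valuation
`w : L → ℤᵐ⁰`, written multiplicatively, so that `w y = exp (-ord_w y)`.  If `L` is a finite
extension of `𝔽_q(T)`, every place of `L` (a proper valuation ring of `L`; it contains `𝔽_q`) is
discrete, so that each place of `L` occurs exactly once. -/
def Place (L : Type*) [Field L] : Type _ :=
  {w : Valuation L ℤᵐ⁰ // Function.Surjective w}

/-- The number `q_w = q ^ deg w` of elements of the residue field of a place. -/
def Place.norm {L : Type*} [Field L] (w : Place L) : ℕ :=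
  Nat.card (IsLocalRing.ResidueField w.1.valuationSubring)

/-- The normalized absolute value `q_w ^ (-ord_w y)`.  If `w` lies over the place `v` of `𝔽_q(T)`
with ramification index `e` and residue degree `f`, and if `|·|_w` extends
`|·|_v = q_v ^ (-ord_v ·)`, then `|y|_w ^ n_w`, where `n_w = e f` is the local degree, is equal to
`q_v ^ (-(ord_w y / e) e f) = q_w ^ (-ord_w y)`. -/
def Place.absVal {L : Type*} [Field L] (w : Place L) (y : L) : ℝ :=
  open Classical in if y = 0 then 0 else (w.norm : ℝ) ^ WithZero.log (w.1 y)

/-- `H_L(y) = ∏_w max (|y|_w ^ n_w, 1)`, over all places `w` of `L`. -/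
def fieldHeight (L : Type*) [Field L] (y : L) : ℝ :=
  ∏ᶠ w : Place L, max (w.absVal y) 1

/-- An algebraic closure of the field `𝔽_q(T)`. -/
abbrev KBar (F : Type*) [Field F] : Type _ := AlgebraicClosure (RatFunc F)

/-- The absolute height `H(y) = H_L(y) ^ (1 / [L : K])` with `K = 𝔽_q(T)` and `L = K(y)`. -/
def absHeight {F : Type*} [Field F] (y : KBar F) : ℝ :=
  fieldHeight (IntermediateField.adjoin (RatFunc F) {y})
      (IntermediateField.AdjoinSimple.gen (RatFunc F) y) ^
    ((Module.finrank (RatFunc F) (IntermediateField.adjoin (RatFunc F) {y}) : ℝ)⁻¹)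

/-- The logarithmic height `log_q H(y)`. -/
def logHeight {F : Type*} [Field F] (y : KBar F) : ℝ :=
  Real.logb (Nat.card F) (absHeight y)

/-! ### The curves `d y² = f(x)` -/

/-- The points over `L` of the curve `d y² = f(x)`, with a point at infinity. -/
inductive TwistPoint {L : Type*} [Field L] (f : L[X]) (d : L) : Type _
  | infinity : TwistPoint f d
  | affine (x y : L) (h : d * y ^ 2 = f.eval x) : TwistPoint f d

/-- Points of the curve over a larger field. -/
def TwistPoint.map {L M : Type*} [Field L] [Field M] (φ : L →+* M) {f : L[X]} {d : L} :
    TwistPoint f d → TwistPoint (f.map φ) (φ d)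
  | .infinity => .infinity
  | .affine x y h => .affine (φ x) (φ y) (by
      rw [eval_map, eval₂_hom, ← h, map_mul, map_pow])

/-- The map `(x, y) ↦ (x, s y)`, where `s² = d`, from `d y² = f(x)` to `y² = f(x)`. -/
def TwistPoint.untwist {L : Type*} [Field L] {f : L[X]} {d : L} (s : L) (hs : s ^ 2 = d) :
    TwistPoint f d → TwistPoint f 1
  | .infinity => .infinity
  | .affine x y h => .affine x (s * y) (by rw [← h, ← hs]; ring)

/-- The height `h_x` with respect to the coordinate `x`. -/
def TwistPoint.heightX {F : Type*} [Field F] {f : (KBar F)[X]} {d : KBar F} :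
    TwistPoint f d → ℝ
  | .infinity => 0
  | .affine x _ _ => logHeight x

/-- The height `h_y` with respect to the coordinate `y`. -/
def TwistPoint.heightY {F : Type*} [Field F] {f : (KBar F)[X]} {d : KBar F} :
    TwistPoint f d → ℝ
  | .infinity => 0
  | .affine _ y _ => logHeight y

/-! ### The group law for cubic `f` -/

/-- The conditions under which `d y² = f(x)` is an elliptic curve over `L` (with `f` monic). -/
structure IsEllipticTwist {L : Type*} [Field L] (f : L[X]) (d : L) : Prop where
  two_ne_zero : (2 : L) ≠ 0
  monic : f.Monic
  natDegree_eq : f.natDegree = 3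
  discr_ne_zero : f.discr ≠ 0
  d_ne_zero : d ≠ 0

/-- The Weierstrass equation of `d y² = f(x)` in the coordinates `X = d x`, `Y = d² y`, for
`f = x³ + a x² + b x + c`: it is `Y² = X³ + d a X² + d² b X + d³ c`. -/
def twistModel {L : Type*} [Field L] (f : L[X]) (d : L) : WeierstrassCurve.Affine L where
  a₁ := 0
  a₂ := d * f.coeff 2
  a₃ := 0
  a₄ := d ^ 2 * f.coeff 1
  a₆ := d ^ 3 * f.coeff 0

namespace IsEllipticTwist

variable {L : Type*} [Field L] {f : L[X]} {d : L}

theorem eval_eq (h : IsEllipticTwist f d) (x : L) :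
    f.eval x = x ^ 3 + f.coeff 2 * x ^ 2 + f.coeff 1 * x + f.coeff 0 := by
  have h3 : f.coeff 3 = 1 := by
    have := h.monic.coeff_natDegree
    rwa [h.natDegree_eq] at this
  rw [eval_eq_sum_range, h.natDegree_eq]
  simp only [Finset.sum_range_succ, Finset.sum_range_zero, h3]
  ring

theorem Δ_ne_zero (h : IsEllipticTwist f d) : (twistModel f d).Δ ≠ 0 := by
  have h3 : f.coeff 3 = 1 := by
    have := h.monic.coeff_natDegree
    rwa [h.natDegree_eq] at this
  have hdeg : f.degree = 3 := by
    rw [degree_eq_natDegree h.monic.ne_zero, h.natDegree_eq]; rfl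
  have key : (twistModel f d).Δ = 2 ^ 4 * d ^ 6 * f.discr := by
    rw [discr_of_degree_eq_three hdeg, h3]
    simp only [twistModel, WeierstrassCurve.Δ, WeierstrassCurve.b₂, WeierstrassCurve.b₄,
      WeierstrassCurve.b₆, WeierstrassCurve.b₈]
    ring
  rw [key]
  exact mul_ne_zero (mul_ne_zero (pow_ne_zero _ h.two_ne_zero) (pow_ne_zero _ h.d_ne_zero))
    h.discr_ne_zero

theorem nonsingular (h : IsEllipticTwist f d) {x y : L} (hxy : d * y ^ 2 = f.eval x) :
    (twistModel f d).Nonsingular (d * x) (d ^ 2 * y) := by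
  refine ((twistModel f d).equation_iff_nonsingular_of_Δ_ne_zero h.Δ_ne_zero).mp ?_
  rw [WeierstrassCurve.Affine.equation_iff]
  rw [h.eval_eq] at hxy
  simp only [twistModel]
  linear_combination d ^ 3 * hxy

theorem equation (h : IsEllipticTwist f d) {x y : L} (hxy : (twistModel f d).Nonsingular x y) :
    d * (y / d ^ 2) ^ 2 = f.eval (x / d) := by
  have hd := h.d_ne_zero
  have := (WeierstrassCurve.Affine.equation_iff _ _).mp hxy.1
  simp only [twistModel] at this
  rw [h.eval_eq]
  field_simp
  linear_combination this

/-- The points of `d y² = f(x)` correspond to the points of its Weierstrass model, by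
`(x, y) ↦ (d x, d² y)`. -/
def equiv (h : IsEllipticTwist f d) : TwistPoint f d ≃ (twistModel f d).Point where
  toFun
    | .infinity => .zero
    | .affine x y hxy => .some (d * x) (d ^ 2 * y) (h.nonsingular hxy)
  invFun
    | .zero => .infinity
    | .some x y hxy => .affine (x / d) (y / d ^ 2) (h.equation hxy)
  left_inv := by
    have hd := h.d_ne_zero
    rintro (_ | ⟨x, y, hxy⟩)
    · rfl
    · simp only [TwistPoint.affine.injEq]
      constructor <;> field_simp
  right_inv := by
    have hd := h.d_ne_zero
    rintro (_ | ⟨x, y, hxy⟩)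
    · rfl
    · simp only [WeierstrassCurve.Affine.Point.some.injEq]
      constructor <;> field_simp

/-- The multiple `[n]P` for the group law of the elliptic curve `d y² = f(x)` with the point at
infinity as its origin. -/
def mul (h : IsEllipticTwist f d) (n : ℕ) (P : TwistPoint f d) : TwistPoint f d :=
  open Classical in h.equiv.symm (n • h.equiv P)

end IsEllipticTwist

/-- The sequence `h_x([n]P) / (2 n²)`. -/
def IsEllipticTwist.heightSeq {F : Type*} [Field F] {f : (KBar F)[X]} {d : KBar F}
    (h : IsEllipticTwist f d) (P : TwistPoint f d) (n : ℕ) : ℝ :=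
  (h.mul n P).heightX / (2 * (n : ℝ) ^ 2)

/-- The canonical height `ĥ(P) = (1/2) lim h_x([n]P) / n²`. -/
def IsEllipticTwist.canonicalHeight {F : Type*} [Field F] {f : (KBar F)[X]} {d : KBar F}
    (h : IsEllipticTwist f d) (P : TwistPoint f d) : ℝ :=
  limUnder atTop (h.heightSeq P)

/-! ### Base change from `𝔽_q[T]` -/

/-- The polynomial `f`, with coefficients in `𝔽_q[T]`, over `𝔽_q(T)`. -/
abbrev overK {F : Type*} [Field F] (f : F[X][X]) : (RatFunc F)[X] :=
  f.map (algebraMap F[X] (RatFunc F))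

/-- The inclusion of `𝔽_q(T)` in its algebraic closure. -/
abbrev toKBar (F : Type*) [Field F] : RatFunc F →+* KBar F :=
  algebraMap (RatFunc F) (KBar F)

/-- The element `d ∈ 𝔽_q[T]` as an element of `𝔽_q(T)`. -/
abbrev inK {F : Type*} [Field F] (d : F[X]) : RatFunc F := algebraMap F[X] (RatFunc F) d

/-- The point `(x, y)` of `d y² = f(x)`, with coordinates in `𝔽_q(T)`, as a point over the
algebraic closure of `𝔽_q(T)`. -/
def pointOfK {F : Type*} [Field F] {f : F[X][X]} {d : F[X]} (x y : RatFunc F)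
    (hP : inK d * y ^ 2 = (overK f).eval x) :
    TwistPoint ((overK f).map (toKBar F)) (toKBar F (inK d)) :=
  (TwistPoint.affine x y hP).map (toKBar F)

theorem isEllipticTwist_overKBar {F : Type*} [Field F] {f : F[X][X]} (h2 : ringChar F ≠ 2)
    (hf : f.Monic) (hdeg : f.natDegree = 3) (hdisc : f.discr ≠ 0) {d : KBar F} (hd : d ≠ 0) :
    IsEllipticTwist ((overK f).map (toKBar F)) d := by
  have hinj : Function.Injective ((toKBar F).comp (algebraMap F[X] (RatFunc F))) :=
    (toKBar F).injective.comp (IsFractionRing.injective F[X] (RatFunc F))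
  have hmap : (overK f).map (toKBar F) =
      f.map ((toKBar F).comp (algebraMap F[X] (RatFunc F))) := Polynomial.map_map _ _ _
  have hm := hf.map ((toKBar F).comp (algebraMap F[X] (RatFunc F)))
  have hn : (f.map ((toKBar F).comp (algebraMap F[X] (RatFunc F)))).natDegree = 3 := by
    rw [hf.natDegree_map, hdeg]
  rw [hmap]
  refine ⟨?_, hm, hn, ?_, hd⟩
  · have h2F : (2 : F) ≠ 0 := Ring.two_ne_zero h2
    have := (map_ne_zero (((toKBar F).comp (algebraMap F[X] (RatFunc F))).comp C)).mpr h2F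
    simpa only [map_ofNat] using this
  · have e1 : f.degree = 3 := by
      rw [degree_eq_natDegree hf.ne_zero, hdeg]; rfl
    have e2 : (f.map ((toKBar F).comp (algebraMap F[X] (RatFunc F)))).degree = 3 := by
      rw [degree_eq_natDegree hm.ne_zero, hn]; rfl
    have : (f.map ((toKBar F).comp (algebraMap F[X] (RatFunc F)))).discr =
        ((toKBar F).comp (algebraMap F[X] (RatFunc F))) f.discr := by
      rw [discr_of_degree_eq_three e1, discr_of_degree_eq_three e2]
      simp only [coeff_map, map_sub, map_add, map_mul, map_pow, map_ofNat]
    rw [this]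
    exact (map_ne_zero_iff _ hinj).mpr hdisc

theorem inKBar_ne_zero {F : Type*} [Field F] {d : F[X]} (hd : Squarefree d) :
    toKBar F (inK d) ≠ 0 :=
  (map_ne_zero (toKBar F)).mpr
    ((map_ne_zero_iff _ (IsFractionRing.injective F[X] (RatFunc F))).mpr hd.ne_zero)

/-- `E_d : d y² = f(x)` is an elliptic curve. -/
theorem twist_elliptic {F : Type*} [Field F] {f : F[X][X]} (h2 : ringChar F ≠ 2)
    (hf : f.Monic) (hdeg : f.natDegree = 3) (hdisc : f.discr ≠ 0) {d : F[X]} (hd : Squarefree d) :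
    IsEllipticTwist ((overK f).map (toKBar F)) (toKBar F (inK d)) :=
  isEllipticTwist_overKBar h2 hf hdeg hdisc (inKBar_ne_zero hd)

/-- `E = E_1 : y² = f(x)` is an elliptic curve. -/
theorem curve_elliptic {F : Type*} [Field F] {f : F[X][X]} (h2 : ringChar F ≠ 2)
    (hf : f.Monic) (hdeg : f.natDegree = 3) (hdisc : f.discr ≠ 0) :
    IsEllipticTwist ((overK f).map (toKBar F)) (1 : KBar F) :=
  isEllipticTwist_overKBar h2 hf hdeg hdisc one_ne_zero

end

/-! Everything reduces to degrees of elements of K = 𝔽_q(T). If z^m = u lies in K, then log_q H(z) =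
deg u / m, where deg u is the degree of u as a rational map (`logHeight_of_pow_eq`): the height
counts poles of u, which are zeros of v = 1/u, and these are counted by the formula Σ e f = [L :
𝔽_q(v)].

Lower bound for h_y: since (√d y)² = d y², the claim is deg(d y²) ≥ (3/4) deg d. Let y = u/v be
reduced, e = gcd(d, v), d = e d', v = e v'. Then d y² = d'u² / (e v'²) is reduced. It also equals
f(x), whose reduced denominator is b^n, with b the denominator of x and n = deg f ≥ 2. Since e is
squarefree and divides b^n, e² divides b^n, hence e v'², so e divides v'
(`exists_squarefree_factorization`). The degree is therefore at least max(deg d', 3 deg e), while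
deg d = deg d' + deg e.

Canonical heights: in the coordinate x, the quadratic map giving x(P ± Q) from x(P), x(Q) is the
same for all twists (`symProd_twistRep_add_sub`). So h_x satisfies the parallelogram law on every
E_d(K) with a single error constant, and Tate's argument gives the limits together with ĥ ≥ h_x/2 -
C uniformly in d. The map P ↦ P' is a homomorphism preserving x, so the height sequences of P and P'
agree term by term (`heightSeq_eq_of_equiv_eq_twistTransport`). The last bound follows from (3/4)
deg d ≤ deg f(x) ≤ 3 deg x + M. -/

noncomputable section

/-! ### Finiteness of integral closures over `𝔽_q[T]` -/

/-- A module that embeds semilinearly, along a finite ring homomorphism, into a finite module over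
a Noetherian ring is finite. -/
theorem Module.Finite.of_semilinear_injective {R S M N : Type*} [CommRing R] [CommRing S]
    [IsNoetherianRing R] [AddCommGroup M] [AddCommGroup N] [Module R M] [Module S N]
    [Module.Finite S N] (σ : R →+* S) (hσ : σ.Finite) (f : M →+ N)
    (hsmul : ∀ (r : R) (m : M), f (r • m) = σ r • f m) (hf : Function.Injective f) :
    Module.Finite R M := by
  let : Algebra R S := σ.toAlgebra
  let : Module R N := Module.compHom N σ
  have : IsScalarTower R S N := ⟨fun r s n => by
    rw [Algebra.smul_def, mul_smul]; rfl⟩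
  have : Module.Finite R S := hσ
  have : Module.Finite R N := Module.Finite.trans S N
  let g : M →ₗ[R] N := { f with map_smul' := hsmul }
  exact Module.Finite.of_injective g hf

/-- Integrality is clear, so finite type is enough; it can be tested on constants, where Frobenius
is surjective because `F` is finite. -/
theorem iterateFrobenius_polynomial_finite (F : Type*) [Field F] [Finite F] (p n : ℕ)
    [ExpChar F p] : (iterateFrobenius F[X] p n).Finite := by
  have hint : (iterateFrobenius F[X] p n).IsIntegral := fun r => by
    refine ⟨X ^ p ^ n - C r, monic_X_pow_sub_C _ (pow_pos (expChar_pos F p) n).ne', ?_⟩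
    simp [iterateFrobenius_def]
  refine hint.to_finite (RingHom.FiniteType.of_comp_finiteType (f := (C : F →+* F[X])) ?_)
  have hcomp : (iterateFrobenius F[X] p n).comp (C : F →+* F[X]) =
      (C : F →+* F[X]).comp (iterateFrobenius F p n) := by
    ext a
    simp [iterateFrobenius_def]
  rw [hcomp]
  refine RingHom.FiniteType.comp ?_ (RingHom.FiniteType.of_surjective _ ?_)
  · exact RingHom.finiteType_algebraMap.mpr (inferInstance : Algebra.FiniteType F F[X])
  · exact Finite.surjective_of_injective (iterateFrobenius F p n).injective

/-- `L / K` may be inseparable, and the standard finiteness theorem covers only the separable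
closure `E`. Some power p^n carries `L` into `E`, and b ↦ b^(p^n) embeds the integral closure in
`L`, Frobenius-semilinearly, into the one in `E`. -/
theorem finite_integralClosure_polynomial (F K L : Type*) [Field F] [Finite F] [Field K] [Field L]
    [Algebra F[X] K] [IsFractionRing F[X] K] [Algebra K L] [Algebra F[X] L]
    [IsScalarTower F[X] K L] [FiniteDimensional K L] :
    Module.Finite F[X] (integralClosure F[X] L) := by
  obtain ⟨p, hp⟩ := ExpChar.exists F
  have : ExpChar F[X] p := expChar_of_injective_ringHom C_injective p
  have : ExpChar K p := expChar_of_injective_ringHom (IsFractionRing.injective F[X] K) p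
  let E := separableClosure K L
  have : ExpChar E p := expChar_of_injective_ringHom (algebraMap K E).injective p
  have : ExpChar L p := expChar_of_injective_ringHom (algebraMap K L).injective p
  have : Module.Finite F[X] (integralClosure F[X] E) :=
    IsIntegralClosure.finite F[X] K E (integralClosure F[X] E)
  obtain ⟨n, hn⟩ := (IsPurelyInseparable.hasExponent_iff' E L p).mp inferInstance
  have : IsScalarTower F[X] E L := IsScalarTower.of_algebraMap_eq fun x => by
    rw [IsScalarTower.algebraMap_apply F[X] K L, IsScalarTower.algebraMap_apply K E L,
      ← IsScalarTower.algebraMap_apply F[X] K E]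
  have key : ∀ b : integralClosure F[X] L,
      ∃ e : integralClosure F[X] E, algebraMap E L e = (b : L) ^ p ^ n := by
    intro b
    obtain ⟨e, he⟩ := hn b
    have : IsIntegral F[X] e := by
      rw [← isIntegral_algebraMap_iff (B := L) (algebraMap E L).injective, he]
      exact b.2.pow _
    exact ⟨⟨e, this⟩, he⟩
  choose φ hφ using key
  have inj : Function.Injective fun e : integralClosure F[X] E => algebraMap E L e :=
    (algebraMap E L).injective.comp Subtype.val_injective
  let f : integralClosure F[X] L →+ integralClosure F[X] E :=
    AddMonoidHom.mk' φ fun a b => inj (by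
      simp only [hφ, AddMemClass.coe_add, map_add, add_pow_expChar_pow])
  refine Module.Finite.of_semilinear_injective (iterateFrobenius F[X] p n)
    (iterateFrobenius_polynomial_finite F p n) f (fun r m => inj ?_) fun a b hab => ?_
  · change algebraMap E L (φ (r • m)) = algebraMap E L (iterateFrobenius F[X] p n r • (φ m : E))
    have h1 : ((r • m : integralClosure F[X] L) : L) = algebraMap F[X] L r * (m : L) :=
      Algebra.smul_def r (m : L)
    rw [hφ, h1, Algebra.smul_def (A := E), map_mul, hφ m, iterateFrobenius_def,
      ← IsScalarTower.algebraMap_apply F[X] E L, map_pow, mul_pow]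
  · have : (a : L) ^ p ^ n = (b : L) ^ p ^ n := by rw [← hφ, ← hφ]; exact congrArg _ (congrArg _ hab)
    exact Subtype.ext (iterateFrobenius_inj L p n this)

/-! ### Places and prime ideals -/

section Places

open IsDedekindDomain HeightOneSpectrum

variable {B L : Type*} [CommRing B] [IsDedekindDomain B] [Field L] [Algebra B L]
  [IsFractionRing B L]

/-- The place of the fraction field defined by a maximal ideal of a Dedekind domain. -/
def IsDedekindDomain.HeightOneSpectrum.place (L : Type*) [Field L] [Algebra B L]
    [IsFractionRing B L] (v : HeightOneSpectrum B) : Place L :=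
  ⟨v.valuation L, v.valuation_surjective L⟩

theorem IsDedekindDomain.HeightOneSpectrum.place_injective :
    Function.Injective (place L : HeightOneSpectrum B → Place L) := fun v w h =>
  eq_of_valuation_isEquiv_valuation (K := L) (by
    rw [show v.valuation L = w.valuation L from congrArg Subtype.val h])

/-- The residue field at the place of a maximal ideal is the quotient by the ideal. -/
theorem IsDedekindDomain.HeightOneSpectrum.norm_place (v : HeightOneSpectrum B) :
    (v.place L).norm = v.asIdeal.cardQuot := by
  have : v.asIdeal.IsMaximal := v.isMaximal
  let O := (v.valuation L).valuationSubring
  let i : B →+* O := (algebraMap B L).codRestrict O.toSubring fun b => v.valuation_le_one b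
  let g : B →+* IsLocalRing.ResidueField O := (IsLocalRing.residue O).comp i
  have hunit : ∀ a : O, IsLocalRing.residue O a = 0 ↔ v.valuation L (a : L) < 1 := fun a => by
    rw [IsLocalRing.residue_eq_zero_iff, ← Valuation.mem_maximalIdeal_iff]
  have hker : ∀ b, g b = 0 ↔ b ∈ v.asIdeal := fun b => by
    rw [← v.valuation_lt_one_iff_mem (K := L)]
    exact hunit (i b)
  let e : B ⧸ v.asIdeal →+* IsLocalRing.ResidueField O :=
    Ideal.Quotient.lift v.asIdeal g fun b hb => (hker b).mpr hb
  let _ : Field (B ⧸ v.asIdeal) := Ideal.Quotient.field v.asIdeal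
  have hsurj : Function.Surjective e := by
    intro z
    obtain ⟨x, rfl⟩ := IsLocalRing.residue_surjective z
    -- An integral element is a fraction with denominator outside the ideal, so its residue is a
    -- quotient of residues from `B`.
    obtain ⟨n, d, hnd⟩ := exists_primeCompl_mul_eq_of_integer v (x : L) x.2
    have hd : g d ≠ 0 := fun h => d.2 ((hker _).mp h)
    refine ⟨Ideal.Quotient.mk _ n / Ideal.Quotient.mk _ (d : B), ?_⟩
    rw [map_div₀]
    refine (div_eq_iff hd).mpr ?_
    change IsLocalRing.residue O (i n) = IsLocalRing.residue O x * IsLocalRing.residue O (i d)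
    rw [← map_mul]
    exact congrArg _ (Subtype.ext hnd.symm)
  exact (Nat.card_congr (Equiv.ofBijective e ⟨e.injective, hsurj⟩)).symm

/-- A normalized valuation for which all elements of a Dedekind domain are integral belongs to a
maximal ideal. -/
theorem Valuation.exists_eq_heightOneSpectrum_valuation (w : Valuation L ℤᵐ⁰)
    (hsurj : Function.Surjective w) (hw : ∀ b : B, w (algebraMap B L b) ≤ 1) :
    ∃ v : HeightOneSpectrum B, w = v.valuation L := by
  let O := w.valuationSubring
  let i : B →+* O := (algebraMap B L).codRestrict O.toSubring hw
  let P : Ideal B := (IsLocalRing.maximalIdeal O).comap i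
  have hP : ∀ b, b ∈ P ↔ w (algebraMap B L b) < 1 := fun b => by
    rw [Ideal.mem_comap]
    exact Valuation.mem_maximalIdeal_iff (v := w) (a := i b)
  obtain ⟨x, hx⟩ := hsurj (WithZero.exp (-1))
  have hx0 : x ≠ 0 := by
    rintro rfl
    rw [map_zero] at hx
    exact WithZero.exp_ne_zero hx.symm
  -- Otherwise `w` would be trivial on `B`, hence on `L`, against the value of `x`.
  have hbot : P ≠ ⊥ := by
    intro h
    have h1 : ∀ b : B, b ≠ 0 → w (algebraMap B L b) = 1 := fun b hb =>
      le_antisymm (hw b) (not_lt.mp fun hlt => hb (by simpa [h] using (hP b).mpr hlt))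
    obtain ⟨a, b, hb, rfl⟩ := IsFractionRing.div_surjective (A := B) x
    have ha : a ≠ 0 := by
      rintro rfl
      simp at hx0
    rw [map_div₀, h1 b (nonZeroDivisors.ne_zero hb), div_one, h1 a ha] at hx
    simpa using congrArg WithZero.log hx
  let v : HeightOneSpectrum B := ⟨P, Ideal.IsPrime.comap i, hbot⟩
  have hle : ∀ z : L, v.valuation L z ≤ 1 → w z ≤ 1 := by
    intro z hz
    obtain ⟨n, d, hnd⟩ := exists_primeCompl_mul_eq_of_integer v z hz
    have hd : w (algebraMap B L d) = 1 :=
      le_antisymm (hw d) (not_lt.mp fun hlt => d.2 ((hP d).mpr hlt))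
    have := congrArg w hnd
    rw [map_mul, hd, mul_one] at this
    exact this ▸ hw n
  have hone : ∀ z : L, v.valuation L z = 1 → w z = 1 := by
    intro z hz
    refine le_antisymm (hle z hz.le) ?_
    have := hle z⁻¹ (by rw [map_inv₀, hz, inv_one])
    have hz0 : w z ≠ 0 := by
      rw [Valuation.ne_zero_iff]
      rintro rfl
      simp at hz
    rwa [map_inv₀, inv_le_one₀ (zero_lt_iff.mpr hz0)] at this
  obtain ⟨π, hπ⟩ := v.valuation_surjective L (WithZero.exp (-1))
  have hπ0 : π ≠ 0 := by
    rintro rfl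
    rw [map_zero] at hπ
    exact WithZero.exp_ne_zero hπ.symm
  -- Units of `v` are units of `w`, so `w` is determined by its value at a uniformizer of `v`.
  have hpow : ∀ z : L, z ≠ 0 → w z = w π ^ (-WithZero.log (v.valuation L z)) := by
    intro z hz
    have h0 : v.valuation L z ≠ 0 := (Valuation.ne_zero_iff _).mpr hz
    have hvz : v.valuation L (π ^ (-WithZero.log (v.valuation L z))) = v.valuation L z := by
      rw [map_zpow₀, hπ, ← WithZero.exp_zsmul, smul_eq_mul, neg_mul_neg, mul_one,
        WithZero.exp_log h0]
    have := hone (z / π ^ (-WithZero.log (v.valuation L z))) (by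
      rw [map_div₀, hvz, div_self h0])
    rw [map_div₀, map_zpow₀] at this
    exact eq_of_div_eq_one this
  -- The value -1 taken at `x` is a multiple of log w(π), which is therefore ±1; integrality of `π`
  -- fixes the sign.
  have hπ1 : w π = WithZero.exp (-1) := by
    have hwπ : w π ≠ 0 := (Valuation.ne_zero_iff _).mpr hπ0
    have h1 : WithZero.log (w π) ≤ 0 := by
      have : w π ≤ 1 := hle π (by rw [hπ, ← WithZero.exp_zero, WithZero.exp_le_exp]; simp)
      simpa using (WithZero.log_le_log hwπ one_ne_zero).mpr this
    have h2 := congrArg WithZero.log (hpow x hx0)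
    rw [hx, WithZero.log_exp, WithZero.log_zpow, smul_eq_mul] at h2
    have h3 : IsUnit (WithZero.log (w π)) := by
      refine IsUnit.of_mul_eq_one (WithZero.log (v.valuation L x)) ?_
      linarith
    rcases Int.isUnit_iff.mp h3 with h | h
    · omega
    · rw [← h, WithZero.exp_log hwπ]
  refine ⟨v, Valuation.ext fun z => ?_⟩
  by_cases hz : z = 0
  · simp [hz]
  · rw [hpow z hz, hπ1, ← WithZero.exp_zsmul, smul_eq_mul, neg_mul_neg, mul_one,
      WithZero.exp_log ((Valuation.ne_zero_iff _).mpr hz)]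

theorem Place.exists_eq_place (w : Place L) (hw : ∀ b : B, w.1 (algebraMap B L b) ≤ 1) :
    ∃ v : HeightOneSpectrum B, w = v.place L := by
  obtain ⟨v, hv⟩ := w.1.exists_eq_heightOneSpectrum_valuation w.2 hw
  exact ⟨v, Subtype.ext hv⟩

end Places

/-! ### The height of a function as a degree -/

section HeightDegree

open IsDedekindDomain HeightOneSpectrum

theorem Valuation.le_one_of_isIntegral {A L Γ : Type*} [CommRing A] [Field L] [Algebra A L]
    [LinearOrderedCommGroupWithZero Γ] (w : Valuation L Γ)
    (hw : ∀ a : A, w (algebraMap A L a) ≤ 1) {b : L} (hb : IsIntegral A b) : w b ≤ 1 := by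
  obtain ⟨p, hm, hp⟩ := hb
  let i : A →+* w.integer := (algebraMap A L).codRestrict w.integer hw
  have : IsIntegral w.integer b := ⟨p.map i, hm.map i, by
    rw [eval₂_map]
    exact hp⟩
  exact Valuation.Integers.mem_of_integral (Valuation.integer.integers w) this

/-- Nonzero constants are roots of unity, so only the variable needs a hypothesis. -/
theorem Valuation.algebraMap_polynomial_le_one {F L Γ : Type*} [Field F] [Finite F] [Field L]
    [Algebra F[X] L] [LinearOrderedCommGroupWithZero Γ] (w : Valuation L Γ)
    (hX : w (algebraMap F[X] L X) ≤ 1) (a : F[X]) : w (algebraMap F[X] L a) ≤ 1 := by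
  induction a using Polynomial.induction_on' with
  | add p q hp hq =>
    rw [map_add]
    exact (w.map_add _ _).trans (max_le hp hq)
  | monomial n c =>
    rw [← C_mul_X_pow_eq_monomial, map_mul, map_mul, map_pow, map_pow]
    have : w (algebraMap F[X] L (C c)) ≤ 1 :=
      FiniteField.valuation_algebraMap_le_one (a := c) (v := w.comap (algebraMap F[X] L))
    exact mul_le_one' this (pow_le_one' hX n)

variable {L : Type*} [Field L]

theorem Place.absVal_le_one (w : Place L) {y : L} (hy : w.1 y ≤ 1) : w.absVal y ≤ 1 := by
  unfold Place.absVal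
  split_ifs with h
  · exact zero_le_one
  · have h0 : w.1 y ≠ 0 := (Valuation.ne_zero_iff _).mpr h
    have hlog : WithZero.log (w.1 y) ≤ 0 := by
      rwa [← WithZero.log_one, WithZero.log_le_log h0 one_ne_zero]
    -- `Nat.card` is 0 when the residue field is infinite; the powers of 0 are still at most 1.
    rcases Nat.eq_zero_or_pos w.norm with hn | hn
    · rw [hn, Nat.cast_zero]
      rcases eq_or_ne (WithZero.log (w.1 y)) 0 with h | h
      · rw [h, zpow_zero]
      · rw [zero_zpow _ h]
        exact zero_le_one
    · exact zpow_le_one_of_nonpos₀ (by exact_mod_cast hn) hlog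

theorem isDedekindDomain_integralClosure_polynomial (F K L : Type*) [Field F] [Finite F]
    [Field K] [Field L] [Algebra F[X] K] [IsFractionRing F[X] K] [Algebra K L] [Algebra F[X] L]
    [IsScalarTower F[X] K L] [FiniteDimensional K L] :
    IsDedekindDomain (integralClosure F[X] L) :=
  have : Module.Finite F[X] (integralClosure F[X] L) := finite_integralClosure_polynomial F K L
  have : IsFractionRing (integralClosure F[X] L) L :=
    IsIntegralClosure.isFractionRing_of_finite_extension F[X] K L (integralClosure F[X] L)
  { isNoetherianRing_iff.mpr (isNoetherian_of_tower F[X] inferInstance),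
    Ring.DimensionLEOne.of_isIntegral F[X] (integralClosure F[X] L),
    (isIntegrallyClosed_iff L).mpr fun {x} hx =>
      ⟨IsIntegralClosure.mk' (integralClosure F[X] L) x (isIntegral_trans (R := F[X]) _ hx),
        IsIntegralClosure.algebraMap_mk' _ _ _⟩ with :
    IsDedekindDomain (integralClosure F[X] L) }

/-- If `L` is a finite extension of `𝔽_q(T)`, then `H_L(1 / T) = q ^ [L : 𝔽_q(T)]`. -/
theorem fieldHeight_inv_X (F K L : Type*) [Field F] [Finite F] [Field K] [Field L]
    [Algebra F[X] K] [IsFractionRing F[X] K] [Algebra K L] [Algebra F[X] L]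
    [IsScalarTower F[X] K L] [FiniteDimensional K L] :
    fieldHeight L (algebraMap F[X] L X)⁻¹ = (Nat.card F : ℝ) ^ Module.finrank K L := by
  let B := integralClosure F[X] L
  have hfin : Module.Finite F[X] B := finite_integralClosure_polynomial F K L
  have hded : IsDedekindDomain B := isDedekindDomain_integralClosure_polynomial F K L
  have hfrac : IsFractionRing B L :=
    IsIntegralClosure.isFractionRing_of_finite_extension F[X] K L B
  have hinj : Function.Injective (algebraMap F[X] L) := by
    rw [IsScalarTower.algebraMap_eq F[X] K L]
    exact (algebraMap K L).injective.comp (IsFractionRing.injective F[X] K)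
  have htf : Module.IsTorsionFree F[X] B := by
    have : FaithfulSMul F[X] B := (faithfulSMul_iff_algebraMap_injective F[X] B).mpr
      (Function.Injective.of_comp (f := algebraMap B L) (by
        rwa [← RingHom.coe_comp, ← IsScalarTower.algebraMap_eq]))
    infer_instance
  let p : Ideal F[X] := Ideal.span {X}
  have hpmax : p.IsMaximal :=
    PrincipalIdealRing.isMaximal_of_irreducible irreducible_X
  have hcard : p.cardQuot = Nat.card F := by
    have : p = Ideal.span {X - C 0} := by rw [C_0, sub_zero]
    rw [this]
    exact Nat.card_congr (quotientSpanXSubCAlgEquiv (0 : F)).toEquiv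
  have ht0 : algebraMap F[X] L X ≠ 0 := fun h => X_ne_zero (hinj (h.trans (map_zero _).symm))
  have hp0 : p ≠ ⊥ := by simp [p]
  let τ : B := algebraMap F[X] B X
  have hτ : algebraMap B L τ = algebraMap F[X] L X :=
    (IsScalarTower.algebraMap_apply F[X] B L X).symm
  have hτ0 : τ ≠ 0 := fun h => ht0 (by rw [← hτ, h, map_zero])
  have hmap : p.map (algebraMap F[X] B) = Ideal.span {τ} := by
    rw [Ideal.map_span, Set.image_singleton]
  have hmap0 : p.map (algebraMap F[X] B) ≠ ⊥ := by simpa [hmap] using hτ0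
  -- The poles of 1/T are the places given by the primes of `B` above (T); each contributes q^(e f),
  -- and Σ e f is the degree.
  let ι : p.primesOver B → HeightOneSpectrum B := fun P =>
    ⟨P.1, P.2.1, Ideal.ne_bot_of_mem_primesOver hp0 P.2⟩
  have hιinj : Function.Injective fun P => (ι P).place L := fun P Q h =>
    Subtype.ext (congrArg HeightOneSpectrum.asIdeal (place_injective h))
  have hval : ∀ P : p.primesOver B,
      ((ι P).place L).1 (algebraMap F[X] L X) = WithZero.exp (-(P.1.ramificationIdx F[X] : ℤ)) := by
    intro P
    have : P.1.LiesOver p := P.2.2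
    have : P.1.IsPrime := P.2.1
    rw [← hτ]
    refine ((ι P).valuation_of_algebraMap τ).trans ?_
    rw [intValuation_eq_exp_neg_multiplicity _ hτ0,
      Ideal.IsDedekindDomain.ramificationIdx_eq_multiplicity p P.1 hmap0, hmap]
  have hterm : ∀ P : p.primesOver B,
      max (((ι P).place L).absVal (algebraMap F[X] L X)⁻¹) 1 =
        (Nat.card F : ℝ) ^ (P.1.ramificationIdx F[X] * P.1.inertiaDeg F[X]) := by
    intro P
    have : P.1.LiesOver p := P.2.2
    have : P.1.IsMaximal := (ι P).isMaximal
    have hnorm : ((ι P).place L).norm = Nat.card F ^ P.1.inertiaDeg F[X] := by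
      rw [← hcard, Ideal.cardQuot_pow_inertiaDeg]
      exact norm_place (ι P)
    rw [Place.absVal, if_neg (inv_ne_zero ht0), map_inv₀, hval, WithZero.log_inv, WithZero.log_exp,
      neg_neg, zpow_natCast, hnorm, Nat.cast_pow, ← pow_mul, mul_comm, max_eq_left]
    exact one_le_pow₀ (by exact_mod_cast Nat.card_pos)
  rw [fieldHeight, ← finprod_mem_univ]
  rw [finprod_mem_inter_mulSupport_eq' _ Set.univ (Set.range fun P => (ι P).place L),
    finprod_mem_range hιinj, finprod_eq_prod_of_fintype]
  · simp_rw [hterm]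
    rw [Finset.prod_pow_eq_pow_sum, Ideal.sum_ramification_inertia_eq_finrank,
      IsFractionRing.finrank_eq F[X] K B L]
  · intro w hw
    simp only [Set.mem_univ, true_iff]
    -- A nontrivial factor forces T to have value below 1, so `B` is integral at `w` and `w` belongs
    -- to a prime above (T).
    have h1 : ¬ w.1 (algebraMap F[X] L X)⁻¹ ≤ 1 := fun h =>
      hw (max_eq_right (w.absVal_le_one h))
    have ht : w.1 (algebraMap F[X] L X) < 1 := by
      rw [map_inv₀] at h1
      by_contra h
      exact h1 (inv_le_one_of_one_le₀ (not_lt.mp h))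
    obtain ⟨v, rfl⟩ := w.exists_eq_place (B := B) fun b =>
      w.1.le_one_of_isIntegral (w.1.algebraMap_polynomial_le_one ht.le)
        ((mem_integralClosure_iff F[X] L).mp b.2)
    have hle : p ≤ v.asIdeal.under F[X] := by
      rw [Ideal.span_singleton_le_iff_mem, Ideal.mem_comap, ← v.valuation_lt_one_iff_mem (K := L)]
      change v.valuation L (algebraMap B L τ) < 1
      rw [hτ]
      exact ht
    exact ⟨⟨v.asIdeal, v.isPrime, ⟨hpmax.eq_of_le (Ideal.IsPrime.under _ _).ne_top hle⟩⟩, rfl⟩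

end HeightDegree

/-! ### Heights of elements with a power in `𝔽_q(T)` -/

theorem Place.absVal_nonneg {L : Type*} [Field L] (w : Place L) (y : L) : 0 ≤ w.absVal y := by
  unfold Place.absVal
  split_ifs
  · exact le_rfl
  · positivity

theorem Place.absVal_pow {L : Type*} [Field L] (w : Place L) (y : L) {m : ℕ} (hm : m ≠ 0) :
    w.absVal (y ^ m) = w.absVal y ^ m := by
  unfold Place.absVal
  by_cases h : y = 0
  · simp [h, hm]
  · rw [if_neg h, if_neg (pow_ne_zero m h), map_pow, WithZero.log_pow, nsmul_eq_mul, mul_comm,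
      zpow_mul, zpow_natCast]

theorem max_pow_one {a : ℝ} (ha : 0 ≤ a) (m : ℕ) : max (a ^ m) 1 = max a 1 ^ m := by
  rcases le_total a 1 with h | h
  · rw [max_eq_right h, max_eq_right (pow_le_one₀ ha h), one_pow]
  · rw [max_eq_left h, max_eq_left (one_le_pow₀ h)]

theorem fieldHeight_pow {L : Type*} [Field L] (y : L) {m : ℕ} (hm : m ≠ 0) :
    fieldHeight L (y ^ m) = fieldHeight L y ^ m := by
  have h : ∀ w : Place L, max (w.absVal (y ^ m)) 1 = max (w.absVal y) 1 ^ m := fun w => by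
    rw [w.absVal_pow y hm, max_pow_one (w.absVal_nonneg y)]
  unfold fieldHeight
  simp_rw [h]
  by_cases hf : (Function.mulSupport fun w : Place L => max (w.absVal y) 1).Finite
  · exact (finprod_pow hf m).symm
  -- With infinitely many nontrivial factors both products take the default value 1.
  · rw [finprod_of_infinite_mulSupport hf, one_pow, finprod_of_infinite_mulSupport]
    refine Set.Infinite.mono (fun w hw => ?_) hf
    rw [Function.mem_mulSupport] at hw ⊢
    rwa [Ne, pow_eq_one_iff_of_nonneg (zero_le_one.trans (le_max_right _ _)) hm]

theorem one_le_fieldHeight {L : Type*} [Field L] (y : L) : 1 ≤ fieldHeight L y :=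
  one_le_finprod fun _ => le_max_right _ _

theorem fieldHeight_algebraMap_finite {F L : Type*} [Field F] [Finite F] [Field L] [Algebra F L]
    (c : F) : fieldHeight L (algebraMap F L c) = 1 := by
  refine finprod_eq_one_of_forall_eq_one fun w => ?_
  exact max_eq_right (w.absVal_le_one (FiniteField.valuation_algebraMap_le_one (a := c) w.1))

open IntermediateField in
-- For transcendental `v` the field `F⟮v⟯` is itself a rational function field with variable `v`, so
-- `fieldHeight_inv_X` applies to `L` over it.
theorem fieldHeight_algebraMap_inv {F K L : Type*} [Field F] [Finite F] [Field K] [Algebra F K]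
    [Field L] [Algebra K L] [FiniteDimensional K L] {v : K} (hv : Transcendental F v)
    [FiniteDimensional F⟮v⟯ K] :
    fieldHeight L (algebraMap K L v)⁻¹ =
      (Nat.card F : ℝ) ^ (Module.finrank F⟮v⟯ K * Module.finrank K L) := by
  let g : F⟮v⟯ := AdjoinSimple.gen F v
  have hg : Function.Injective (aeval g : F[X] →ₐ[F] F⟮v⟯) := by
    refine Function.Injective.of_comp (f := algebraMap F⟮v⟯ K) fun a b hab => ?_
    simp only [Function.comp_apply, ← aeval_algebraMap_apply] at hab
    exact transcendental_iff_injective.mp hv hab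
  -- Here the polynomial variable acts as `v`.
  let _ : Algebra F[X] F⟮v⟯ := (aeval g : F[X] →ₐ[F] F⟮v⟯).toRingHom.toAlgebra
  let _ : Algebra F[X] L := ((algebraMap F⟮v⟯ L).comp (algebraMap F[X] F⟮v⟯)).toAlgebra
  have : IsScalarTower F[X] F⟮v⟯ L := IsScalarTower.of_algebraMap_eq fun _ => rfl
  have : IsFractionRing F[X] F⟮v⟯ := by
    refine ⟨fun a => ?_, fun x => ?_, fun {a b} h => ⟨1, by simpa using hg h⟩⟩
    · exact IsUnit.mk0 _ fun h => nonZeroDivisors.coe_ne_zero a (hg (h.trans (map_zero _).symm))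
    · obtain ⟨r, s, hx⟩ := (mem_adjoin_simple_iff F (x : K)).mp x.2
      have hgs : ∀ a : F[X], ((aeval g a : F⟮v⟯) : K) = aeval v a := fun a =>
        (aeval_algebraMap_apply K g a).symm
      by_cases hs : s = 0
      · refine ⟨(0, 1), Subtype.ext ?_⟩
        simp [hx, hs]
      · refine ⟨(r, ⟨s, mem_nonZeroDivisors_of_ne_zero hs⟩), Subtype.ext ?_⟩
        change (x : K) * ((aeval g s : F⟮v⟯) : K) = ((aeval g r : F⟮v⟯) : K)
        have hs' : aeval v s ≠ 0 := fun h =>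
          hs (transcendental_iff_injective.mp hv (h.trans (map_zero _).symm))
        rw [hgs, hgs, hx, div_mul_cancel₀ _ hs']
  have : FiniteDimensional F⟮v⟯ L := FiniteDimensional.trans F⟮v⟯ K L
  rw [Module.finrank_mul_finrank]
  rw [← fieldHeight_inv_X F F⟮v⟯ L]
  congr 2
  change algebraMap K L v = algebraMap F⟮v⟯ L (aeval g X)
  rw [aeval_X]
  rfl

/-- The degree of a rational function. -/
def RatFunc.mapDegree {F : Type*} [Field F] (u : RatFunc F) : ℕ :=
  max u.num.natDegree u.denom.natDegree

theorem RatFunc.exists_eq_C_of_mapDegree_eq_zero {F : Type*} [Field F] {u : RatFunc F}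
    (h : u.mapDegree = 0) : ∃ c, u = RatFunc.C c :=
  u.eq_C_iff.mpr (Nat.max_eq_zero_iff.mp h)

open IntermediateField in
-- For nonconstant `u`, take v = 1/u as the variable; [F(T) : F(u)] is the larger of the degrees of
-- numerator and denominator. No separate analysis at infinity is needed.
theorem fieldHeight_algebraMap_ratFunc {F L : Type*} [Field F] [Finite F] [Field L]
    [Algebra (RatFunc F) L] [FiniteDimensional (RatFunc F) L] (u : RatFunc F) :
    fieldHeight L (algebraMap (RatFunc F) L u) =
      (Nat.card F : ℝ) ^ (u.mapDegree * Module.finrank (RatFunc F) L) := by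
  by_cases hc : ∃ c, u = RatFunc.C c
  · obtain ⟨c, rfl⟩ := hc
    let _ : Algebra F L := ((algebraMap (RatFunc F) L).comp RatFunc.C).toAlgebra
    have h1 : fieldHeight L (algebraMap (RatFunc F) L (RatFunc.C c)) = 1 :=
      fieldHeight_algebraMap_finite (L := L) c
    rw [h1]
    simp [RatFunc.mapDegree]
  · have hadj : F⟮u⁻¹⟯ = F⟮u⟯ := by
      refine le_antisymm (adjoin_simple_le_iff.mpr (inv_mem (mem_adjoin_simple_self F u)))
        (adjoin_simple_le_iff.mpr ?_)
      simpa using inv_mem (mem_adjoin_simple_self F u⁻¹)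
    have hu := RatFunc.transcendental_of_ne_C u hc
    have hv : Transcendental F u⁻¹ := fun h => hu (by simpa using h.inv)
    have hrank : Module.finrank F⟮u⁻¹⟯ (RatFunc F) = u.mapDegree := by
      rw [hadj]
      exact RatFunc.finrank_eq_max_natDegree u
    have : FiniteDimensional F⟮u⁻¹⟯ (RatFunc F) := by
      refine Module.finite_of_finrank_pos (hrank ▸ Nat.pos_of_ne_zero fun h => hc ?_)
      exact RatFunc.exists_eq_C_of_mapDegree_eq_zero h
    have := fieldHeight_algebraMap_inv (L := L) hv
    rwa [hrank, map_inv₀, inv_inv] at this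

/-- H_L(z)^m = H_L(u) = q^(deg u [L : K]), and the normalizing exponent cancels [L : K]. The case m
= 2 serves √d y, the case m = 1 serves rational x-coordinates. -/
theorem logHeight_of_pow_eq {F : Type*} [Field F] [Finite F] {z : KBar F} {m : ℕ} (hm : m ≠ 0)
    {u : RatFunc F} (hz : z ^ m = toKBar F u) : logHeight z = (u.mapDegree : ℝ) / m := by
  let L := IntermediateField.adjoin (RatFunc F) {z}
  let g : L := IntermediateField.AdjoinSimple.gen (RatFunc F) z
  have hint : IsIntegral (RatFunc F) z := IsIntegral.of_pow (Nat.pos_of_ne_zero hm) (by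
    rw [hz]; exact isIntegral_algebraMap)
  have : FiniteDimensional (RatFunc F) L := IntermediateField.adjoin.finiteDimensional hint
  have hn : (Module.finrank (RatFunc F) L : ℝ) ≠ 0 := by
    exact_mod_cast Module.finrank_pos.ne'
  have hg : g ^ m = algebraMap (RatFunc F) L u := Subtype.ext hz
  have hq : (1 : ℝ) < Nat.card F := by exact_mod_cast Finite.one_lt_card
  have key : fieldHeight L g ^ m =
      (Nat.card F : ℝ) ^ (u.mapDegree * Module.finrank (RatFunc F) L) := by
    rw [← fieldHeight_pow g hm, hg, fieldHeight_algebraMap_ratFunc]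
  have hpos : 0 < fieldHeight L g := zero_lt_one.trans_le (one_le_fieldHeight g)
  have hlog := congrArg (Real.logb (Nat.card F)) key
  rw [Real.logb_pow, Real.logb_pow, Real.logb_self_eq_one hq, mul_one, Nat.cast_mul] at hlog
  have hm' : (m : ℝ) ≠ 0 := by exact_mod_cast hm
  change Real.logb _ (fieldHeight L g ^ ((Module.finrank (RatFunc F) L : ℝ)⁻¹)) = _
  rw [Real.logb_rpow_eq_mul_logb_of_pos hpos]
  field_simp
  linarith

/-! ### The absolute values of `F(T)` -/

namespace RatFunc

open IsDedekindDomain HeightOneSpectrum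

variable {F : Type*} [Field F]

variable (F) in
/-- The absolute value `exp (deg u)`. -/
def inftyAbv : AbsoluteValue (RatFunc F) ℝ where
  toFun u := open Classical in if u = 0 then 0 else Real.exp u.intDegree
  map_mul' u v := by
    by_cases hu : u = 0
    · simp [hu]
    by_cases hv : v = 0
    · simp [hv]
    · simp [hu, hv, intDegree_mul, Real.exp_add]
  nonneg' u := by
    split_ifs
    · exact le_rfl
    · positivity
  eq_zero' u := by simp
  add_le' u v := by
    rcases eq_or_ne u 0 with rfl | hu
    · rw [zero_add, if_pos rfl, zero_add]
    rcases eq_or_ne v 0 with rfl | hv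
    · rw [add_zero, if_pos (rfl : (0 : RatFunc F) = 0), add_zero]
    by_cases h : u + v = 0
    · simp only [h, if_true]
      positivity
    · simp only [hu, hv, h, if_false]
      have h1 := intDegree_add_le hv h
      rcases le_max_iff.mp h1 with h2 | h2
      · exact (Real.exp_le_exp.mpr (by exact_mod_cast h2)).trans
          (le_add_of_nonneg_right (Real.exp_pos _).le)
      · exact (Real.exp_le_exp.mpr (by exact_mod_cast h2)).trans
          (le_add_of_nonneg_left (Real.exp_pos _).le)

theorem inftyAbv_apply {u : RatFunc F} (hu : u ≠ 0) : inftyAbv F u = Real.exp u.intDegree :=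
  if_neg hu

/-- The degree of a monic irreducible polynomial. -/
def placeDegree (v : HeightOneSpectrum F[X]) : ℕ :=
  (Submodule.IsPrincipal.generator v.asIdeal).natDegree

theorem placeDegree_eq {v : HeightOneSpectrum F[X]} {π : F[X]} (h : v.asIdeal = Ideal.span {π}) :
    placeDegree v = π.natDegree := by
  refine natDegree_eq_of_degree_eq (degree_eq_degree_of_associated ?_)
  rw [← Ideal.span_singleton_eq_span_singleton, ← h]
  exact v.asIdeal.span_singleton_generator

theorem placeDegree_pos (v : HeightOneSpectrum F[X]) : 0 < placeDegree v := by
  have hspan := v.asIdeal.span_singleton_generator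
  have h0 : Submodule.IsPrincipal.generator v.asIdeal ≠ 0 := fun h =>
    v.ne_bot ((Submodule.IsPrincipal.eq_bot_iff_generator_eq_zero _).mpr h)
  refine natDegree_pos_iff_degree_pos.mpr (degree_pos_of_ne_zero_of_nonunit h0 fun hu => ?_)
  exact v.isPrime.ne_top (by rw [← hspan]; exact Ideal.span_singleton_eq_top.mpr hu)

theorem one_lt_placeBase (v : HeightOneSpectrum F[X]) :
    1 < Real.toNNReal (Real.exp (placeDegree v)) := by
  rw [Real.one_lt_toNNReal, Real.one_lt_exp_iff]
  exact_mod_cast placeDegree_pos v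

/-- The absolute value `exp (-deg π * ord_π u)`. -/
def finiteAbv (v : HeightOneSpectrum F[X]) : AbsoluteValue (RatFunc F) ℝ :=
  v.adicAbv (one_lt_placeBase v)

theorem finiteAbv_injective : Function.Injective (finiteAbv (F := F)) := by
  intro v w h
  refine HeightOneSpectrum.ext (Ideal.ext fun a => ?_)
  rw [← v.adicAbv_coe_lt_one_iff (K := RatFunc F) (one_lt_placeBase v),
    ← w.adicAbv_coe_lt_one_iff (K := RatFunc F) (one_lt_placeBase w)]
  exact iff_of_eq (congrArg (fun f : AbsoluteValue (RatFunc F) ℝ => f _ < 1) h)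

theorem finiteAbv_algebraMap_le_one (v : HeightOneSpectrum F[X]) (a : F[X]) :
    finiteAbv v (algebraMap F[X] (RatFunc F) a) ≤ 1 :=
  v.adicAbv_coe_le_one (K := RatFunc F) (one_lt_placeBase v) a

theorem finiteAbv_algebraMap_eq_one_iff (v : HeightOneSpectrum F[X]) (a : F[X]) :
    finiteAbv v (algebraMap F[X] (RatFunc F) a) = 1 ↔ a ∉ v.asIdeal :=
  v.adicAbv_coe_eq_one_iff (K := RatFunc F) (one_lt_placeBase v) a

theorem hasFiniteMulSupport_finiteAbv_algebraMap {a : F[X]} (ha : a ≠ 0) :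
    (fun v => finiteAbv v (algebraMap F[X] (RatFunc F) a)).HasFiniteMulSupport := by
  refine (Ideal.finite_factors (I := Ideal.span {a}) (by simpa using ha)).subset fun v hv => ?_
  rw [Function.mem_mulSupport, Ne, finiteAbv_algebraMap_eq_one_iff, not_not] at hv
  exact Ideal.dvd_span_singleton.mpr hv

theorem hasFiniteMulSupport_finiteAbv {u : RatFunc F} (hu : u ≠ 0) :
    (fun v => finiteAbv v u).HasFiniteMulSupport := by
  have hn := hasFiniteMulSupport_finiteAbv_algebraMap (num_ne_zero hu)
  have hd := hasFiniteMulSupport_finiteAbv_algebraMap u.denom_ne_zero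
  have : (fun v => finiteAbv v u) = (fun v => finiteAbv v (algebraMap F[X] (RatFunc F) u.num)) /
      fun v => finiteAbv v (algebraMap F[X] (RatFunc F) u.denom) := by
    funext v
    rw [Pi.div_apply, ← map_div₀, num_div_denom]
  rw [this]
  exact hn.div hd

theorem finiteAbv_self {v : HeightOneSpectrum F[X]} {π : F[X]} (h : v.asIdeal = Ideal.span {π})
    (hπ : π ≠ 0) : finiteAbv v (algebraMap F[X] (RatFunc F) π) = Real.exp (-π.natDegree) := by
  refine (v.adicAbv_of_algebraMap (K := RatFunc F) (one_lt_placeBase v) π).trans ?_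
  change ((WithZeroMulInt.toNNReal (ne_zero_of_lt (one_lt_placeBase v)) (v.intValuation π) : NNReal)
    : ℝ) = _
  rw [v.intValuation_singleton hπ h, WithZeroMulInt.toNNReal_neg_apply _ WithZero.exp_ne_zero,
    NNReal.coe_zpow, Real.coe_toNNReal _ (Real.exp_pos _).le, placeDegree_eq h, Real.exp_neg]
  exact zpow_neg_one _

/-- Both sides are multiplicative, and a prime π differs from absolute value 1 only at its own
place. -/
theorem finprod_finiteAbv_algebraMap {a : F[X]} (ha : a ≠ 0) :
    ∏ᶠ v, finiteAbv v (algebraMap F[X] (RatFunc F) a) = Real.exp (-a.natDegree) := by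
  induction a using UniqueFactorizationMonoid.induction_on_prime with
  | h₁ => exact absurd rfl ha
  | h₂ a hu =>
    rw [natDegree_eq_zero_of_isUnit hu, Nat.cast_zero, neg_zero, Real.exp_zero]
    exact finprod_eq_one_of_forall_eq_one fun v => (finiteAbv_algebraMap_eq_one_iff v a).mpr
      fun h => v.isPrime.ne_top (Ideal.eq_top_of_isUnit_mem _ h hu)
  | h₃ a π ha0 hπ ih =>
    have hmul := finprod_mul_distrib (hasFiniteMulSupport_finiteAbv_algebraMap hπ.ne_zero)
      (hasFiniteMulSupport_finiteAbv_algebraMap ha0)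
    simp_rw [map_mul]
    rw [hmul, ih ha0, natDegree_mul hπ.ne_zero ha0, Nat.cast_add, neg_add, Real.exp_add]
    congr 1
    let v : HeightOneSpectrum F[X] := ⟨Ideal.span {π},
      (Ideal.span_singleton_prime hπ.ne_zero).mpr hπ, by simpa using hπ.ne_zero⟩
    rw [finprod_eq_single _ v, finiteAbv_self rfl hπ.ne_zero]
    intro w hw
    rw [finiteAbv_algebraMap_eq_one_iff]
    intro hmem
    refine hw (HeightOneSpectrum.ext ?_)
    exact (v.isMaximal.eq_of_le w.isPrime.ne_top
      ((Ideal.span_singleton_le_iff_mem _).mpr hmem)).symm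

theorem finprod_finiteAbv {u : RatFunc F} (hu : u ≠ 0) :
    ∏ᶠ v, finiteAbv v u = Real.exp (-u.intDegree) := by
  have hn := num_ne_zero hu
  have hdiv := finprod_div_distrib (hasFiniteMulSupport_finiteAbv_algebraMap hn)
    (hasFiniteMulSupport_finiteAbv_algebraMap u.denom_ne_zero)
  simp_rw [← map_div₀, num_div_denom] at hdiv
  rw [hdiv, finprod_finiteAbv_algebraMap hn, finprod_finiteAbv_algebraMap u.denom_ne_zero,
    ← Real.exp_sub, intDegree]
  push_cast
  ring_nf

theorem finprod_range_finiteAbv (g : AbsoluteValue (RatFunc F) ℝ → ℝ) :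
    ∏ᶠ v : Set.range (finiteAbv (F := F)), g v.1 = ∏ᶠ v : HeightOneSpectrum F[X], g (finiteAbv v) := by
  rw [finprod_set_coe_eq_finprod_mem, finprod_mem_range finiteAbv_injective]

/-- Makes the general height estimates available over 𝔽_q(T). The place at infinity sits in
`archAbsVal`, where no ultrametric inequality has to be proved; the base e turns logarithmic heights
into degrees. -/
instance : Height.AdmissibleAbsValues (RatFunc F) where
  archAbsVal := {inftyAbv F}
  nonarchAbsVal := Set.range finiteAbv
  isNonarchimedean := by
    rintro _ ⟨v, rfl⟩
    exact v.isNonarchimedean_adicAbv _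
  hasFiniteMulSupport {u} hu := by
    refine ((hasFiniteMulSupport_finiteAbv hu).image
      fun v => (⟨finiteAbv v, v, rfl⟩ : Set.range (finiteAbv (F := F)))).subset ?_
    rintro ⟨_, v, rfl⟩ hv
    exact ⟨v, hv, rfl⟩
  product_formula {u} hu := by
    rw [finprod_range_finiteAbv fun v => v u, finprod_finiteAbv hu, Multiset.map_singleton,
      Multiset.prod_singleton, inftyAbv_apply hu, ← Real.exp_add, add_neg_cancel, Real.exp_zero]

/-- Numerator and denominator are coprime, so at most one of them is a nonunit at `v`. -/
theorem max_finiteAbv_one (v : HeightOneSpectrum F[X]) (u : RatFunc F) :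
    max (finiteAbv v u) 1 = (finiteAbv v (algebraMap F[X] (RatFunc F) u.denom))⁻¹ := by
  set A := finiteAbv v (algebraMap F[X] (RatFunc F) u.num) with hA
  set B := finiteAbv v (algebraMap F[X] (RatFunc F) u.denom) with hB
  have hu : finiteAbv v u = A / B := by rw [hA, hB, ← map_div₀, num_div_denom]
  have hA1 : A ≤ 1 := finiteAbv_algebraMap_le_one v _
  have hB1 : B ≤ 1 := finiteAbv_algebraMap_le_one v _
  have hB0 : 0 < B := (finiteAbv v).pos (algebraMap_ne_zero u.denom_ne_zero)
  rw [hu]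
  by_cases hd : u.denom ∈ v.asIdeal
  · have hn : u.num ∉ v.asIdeal := fun hn => by
      obtain ⟨r, s, hrs⟩ := u.isCoprime_num_denom
      refine v.isPrime.ne_top ((Ideal.eq_top_iff_one _).mpr (hrs ▸ ?_))
      exact Ideal.add_mem _ (Ideal.mul_mem_left _ _ hn) (Ideal.mul_mem_left _ _ hd)
    rw [show A = 1 from (finiteAbv_algebraMap_eq_one_iff v _).mpr hn, one_div]
    exact max_eq_left ((one_le_inv₀ hB0).mpr hB1)
  · rw [show B = 1 from (finiteAbv_algebraMap_eq_one_iff v _).mpr hd, div_one, inv_one]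
    exact max_eq_right hA1

/-- The finite places contribute deg(denom), the infinite one max(deg(num) - deg(denom), 0). With
`logHeight_of_pow_eq` this links the two notions of height. -/
theorem logHeight₁_eq_mapDegree (u : RatFunc F) : Height.logHeight₁ u = u.mapDegree := by
  by_cases hu : u = 0
  · simp [hu, mapDegree]
  have hfin : ∏ᶠ v, max (finiteAbv v u) 1 = Real.exp u.denom.natDegree := by
    simp_rw [max_finiteAbv_one]
    rw [finprod_inv_distrib, finprod_finiteAbv_algebraMap u.denom_ne_zero, Real.exp_neg, inv_inv]
  have h : Height.mulHeight₁ u = max (inftyAbv F u) 1 * ∏ᶠ v, max (finiteAbv v u) 1 := by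
    rw [Height.mulHeight₁_eq]
    congr 1
    · exact (congrArg Multiset.prod (Multiset.map_singleton _ _)).trans (Multiset.prod_singleton _)
    · exact finprod_range_finiteAbv fun v => max (v u) 1
  rw [Height.logHeight₁_eq_log_mulHeight₁, h, hfin, inftyAbv_apply hu, ← Real.exp_zero,
    ← Real.exp_monotone.map_max, ← Real.exp_add, Real.log_exp, max_add, zero_add, mapDegree,
    intDegree]
  push_cast
  rw [sub_add_cancel]

end RatFunc

/-! ### Transport of points between twists -/

section Transport

open WeierstrassCurve.Affine

variable {K M : Type*} [Field K] [Field M] {f : K[X]} {d : K} {d' u : M} (φ : K →+* M)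

/-- The coefficient a₂ₖ is d^k times a coefficient of f, so it scales by u^(2k), as a Weierstrass
change of variables requires. Base change is u = 1; untwisting is u = √d, d' = 1. -/
theorem twistModel_nonsingular_transport (hu : u ≠ 0) (hd : u ^ 2 * d' = φ d) {x y : K}
    (h : (twistModel f d).Nonsingular x y) :
    (twistModel (f.map φ) d').Nonsingular (φ x / u ^ 2) (φ y / u ^ 3) := by
  have h1 := (equation_iff _ _).mp h.1
  have h2 := (nonsingular_iff _ _).mp h |>.2
  simp only [twistModel] at h1 h2
  have e1 := congrArg φ h1
  simp only [map_add, map_mul, map_pow, ← hd, map_zero] at e1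
  rw [nonsingular_iff, equation_iff]
  simp only [twistModel, coeff_map]
  refine ⟨?_, ?_⟩
  · field_simp
    linear_combination e1
  · rcases h2 with h2 | h2
    · left
      contrapose h2
      apply φ.injective
      simp only [map_add, map_mul, map_pow, ← hd, map_zero, map_ofNat]
      field_simp at h2
      linear_combination h2
    · right
      contrapose h2
      apply φ.injective
      simp only [map_sub, map_neg, map_mul, map_zero]
      field_simp at h2
      linear_combination h2

theorem twistModel_negY_transport (x y : K) :
    (twistModel (f.map φ) d').negY (φ x / u ^ 2) (φ y / u ^ 3) =
      φ ((twistModel f d).negY x y) / u ^ 3 := by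
  simp [negY, twistModel, neg_div]

/-- The slope has weight 1: 4 - 3 for tangents, 3 - 2 for chords. -/
theorem twistModel_slope_transport [DecidableEq K] [DecidableEq M] (hu : u ≠ 0)
    (hd : u ^ 2 * d' = φ d) (x₁ x₂ y₁ y₂ : K) :
    (twistModel (f.map φ) d').slope (φ x₁ / u ^ 2) (φ x₂ / u ^ 2) (φ y₁ / u ^ 3) (φ y₂ / u ^ 3) =
      φ ((twistModel f d).slope x₁ x₂ y₁ y₂) / u := by
  have hx : φ x₁ / u ^ 2 = φ x₂ / u ^ 2 ↔ x₁ = x₂ := by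
    rw [div_left_inj' (pow_ne_zero 2 hu), φ.injective.eq_iff]
  have hy : φ y₁ / u ^ 3 = (twistModel (f.map φ) d').negY (φ x₂ / u ^ 2) (φ y₂ / u ^ 3) ↔
      y₁ = (twistModel f d).negY x₂ y₂ := by
    rw [twistModel_negY_transport (d := d) φ, div_left_inj' (pow_ne_zero 3 hu), φ.injective.eq_iff]
  simp only [WeierstrassCurve.Affine.slope, hx, hy]
  split_ifs with h1 h2
  · simp
  · rw [twistModel_negY_transport (d := d) φ, ← sub_div, ← map_sub, map_div₀]
    have hnum : 3 * (φ x₁ / u ^ 2) ^ 2 + 2 * (twistModel (f.map φ) d').a₂ * (φ x₁ / u ^ 2) +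
        (twistModel (f.map φ) d').a₄ - (twistModel (f.map φ) d').a₁ * (φ y₁ / u ^ 3) =
        φ (3 * x₁ ^ 2 + 2 * (twistModel f d).a₂ * x₁ + (twistModel f d).a₄ -
          (twistModel f d).a₁ * y₁) / u ^ 4 := by
      simp only [twistModel, coeff_map, map_sub, map_add, map_mul, map_pow, map_ofNat, map_zero,
        ← hd]
      field_simp
      ring
    have hdiv : ∀ A B : M, A / u ^ 4 / (B / u ^ 3) = A / B / u := fun A B => by
      rw [div_div_div_eq, div_div, show u ^ 4 * B = u ^ 3 * (B * u) by ring, mul_comm A,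
        mul_div_mul_left _ _ (pow_ne_zero 3 hu)]
    rw [hnum, hdiv]
  · simp only [map_div₀, map_sub]
    have : φ x₁ - φ x₂ ≠ 0 := by
      rw [← map_sub, _root_.map_ne_zero]
      exact sub_ne_zero.mpr h1
    rw [← sub_div, ← sub_div]
    field_simp

/-- The map `(X, Y) ↦ (X / u², Y / u³)` between Weierstrass models of twists. -/
def twistTransport (hu : u ≠ 0) (hd : u ^ 2 * d' = φ d) :
    (twistModel f d).Point → (twistModel (f.map φ) d').Point
  | .zero => .zero
  | .some _ _ h => .some _ _ (twistModel_nonsingular_transport φ hu hd h)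

theorem twistTransport_add [DecidableEq K] [DecidableEq M] (hu : u ≠ 0) (hd : u ^ 2 * d' = φ d)
    (P Q : (twistModel f d).Point) :
    twistTransport φ hu hd (P + Q) = twistTransport φ hu hd P + twistTransport φ hu hd Q := by
  rcases P with _ | ⟨x₁, y₁, h₁⟩
  · change twistTransport φ hu hd (0 + Q) = 0 + _
    rw [zero_add, zero_add]
  rcases Q with _ | ⟨x₂, y₂, h₂⟩
  · change twistTransport φ hu hd (_ + 0) = _ + 0
    rw [add_zero, add_zero]
  have hx : φ x₁ / u ^ 2 = φ x₂ / u ^ 2 ↔ x₁ = x₂ := by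
    rw [div_left_inj' (pow_ne_zero 2 hu), φ.injective.eq_iff]
  have hy : φ y₁ / u ^ 3 = (twistModel (f.map φ) d').negY (φ x₂ / u ^ 2) (φ y₂ / u ^ 3) ↔
      y₁ = (twistModel f d).negY x₂ y₂ := by
    rw [twistModel_negY_transport (d := d) φ, div_left_inj' (pow_ne_zero 3 hu), φ.injective.eq_iff]
  by_cases h : x₁ = x₂ ∧ y₁ = (twistModel f d).negY x₂ y₂
  · rw [Point.add_of_Y_eq h.1 h.2]
    exact (Point.add_of_Y_eq (hx.mpr h.1) (hy.mpr h.2)).symm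
  · rw [Point.add_some h]
    refine Eq.trans ?_ (Point.add_some (fun h' => h ⟨hx.mp h'.1, hy.mp h'.2⟩)).symm
    simp only [twistTransport, Point.some.injEq]
    rw [twistModel_slope_transport φ hu hd]
    simp only [addY, negAddY, addX, negY, twistModel, coeff_map, map_sub, map_add, map_mul, map_pow,
      map_neg, map_zero, ← hd]
    constructor
    · field_simp
      ring
    · field_simp
      ring

theorem twistTransport_nsmul [DecidableEq K] [DecidableEq M] (hu : u ≠ 0) (hd : u ^ 2 * d' = φ d)
    (n : ℕ) (P : (twistModel f d).Point) :
    twistTransport φ hu hd (n • P) = n • twistTransport φ hu hd P := by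
  induction n with
  | zero => simp only [zero_nsmul]; rfl
  | succ n ih => rw [succ_nsmul, succ_nsmul, twistTransport_add, ih]

end Transport

/-! ### The approximate parallelogram law -/

section Parallelogram

open WeierstrassCurve WeierstrassCurve.Affine

/-- The product of two binary linear forms. -/
def symProd {K : Type*} [Field K] (v w : Fin 2 → K) : Fin 3 → K :=
  ![v 0 * w 0, v 0 * w 1 + v 1 * w 0, v 1 * w 1]

/-- The polynomial map `addSubMap` on vectors. -/
def addSubVec {K : Type*} [Field K] (W : WeierstrassCurve K) (x : Fin 3 → K) : Fin 3 → K :=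
  fun i => (addSubMap W i).eval x

theorem addSubVec_apply {K : Type*} [Field K] (W : WeierstrassCurve K) (x : Fin 3 → K) :
    addSubVec W x =
      ![x 0 ^ 2 - W.b₄ * x 0 * x 2 - W.b₆ * x 1 * x 2 - W.b₈ * x 2 ^ 2,
        2 * x 1 * x 0 + W.b₂ * x 0 * x 2 + W.b₄ * x 1 * x 2 + W.b₆ * x 2 ^ 2,
        x 1 ^ 2 - 4 * x 0 * x 2] := by
  funext i
  fin_cases i <;> simp [addSubVec, addSubMap]

theorem symProd_comm {K : Type*} [Field K] (v w : Fin 2 → K) : symProd v w = symProd w v := by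
  simp only [symProd]
  congr 1
  · ring
  · congr 1
    · ring
    · congr 1
      ring

variable {K : Type*} [Field K] [DecidableEq K] (W : WeierstrassCurve.Affine K)

/-- This is the duplication formula, with scalar ψ⁻² for ψ = 2y + a₁x + a₃. If ψ = 0, then 2P = 0
and only the first coordinate survives; it is nonzero because `addSubMap` has no nontrivial zero on
an elliptic curve. -/
theorem symProd_xRep_add_self [W.IsElliptic] (P : W.Point) : ∃ c : K, c ≠ 0 ∧
    symProd (P + P).xRep (0 : W.Point).xRep = c • addSubVec W (symProd P.xRep P.xRep) := by
  rcases P with _ | ⟨x, y, h⟩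
  · refine ⟨1, one_ne_zero, ?_⟩
    change symProd (0 + 0 : W.Point).xRep (0 : W.Point).xRep =
      (1 : K) • addSubVec W (symProd (0 : W.Point).xRep (0 : W.Point).xRep)
    rw [add_zero, Point.xRep_zero, one_smul, addSubVec_apply]
    simp [symProd]
  · have heq := (equation_iff _ _).mp h.1
    by_cases hy : y = W.negY x y
    · rw [Point.add_self_of_Y_eq hy, Point.xRep_zero, Point.xRep_some]
      have hne : addSubVec W (symProd ![x, 1] ![x, 1]) ≠ 0 :=
        addSubMap_ne_zero W (x := symProd ![x, 1] ![x, 1]) fun h0 => by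
          simpa [symProd] using congrFun h0 2
      have hval : addSubVec W (symProd ![x, 1] ![x, 1]) =
          ![addSubVec W (symProd ![x, 1] ![x, 1]) 0, 0, 0] := by
        rw [negY] at hy
        rw [addSubVec_apply]
        funext i
        fin_cases i
        · rfl
        · simp [symProd, b₂, b₄, b₆]
          linear_combination (2 * y + W.a₁ * x + W.a₃) * hy - 4 * heq
        · simp [symProd]
          ring
      have h0 : addSubVec W (symProd ![x, 1] ![x, 1]) 0 ≠ 0 := fun h0 => hne (by
        rw [hval, h0]
        simp)
      refine ⟨(addSubVec W (symProd ![x, 1] ![x, 1]) 0)⁻¹, inv_ne_zero h0, ?_⟩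
      rw [eq_inv_smul_iff₀ h0, hval]
      simp [symProd]
    · have hψ : 2 * y + W.a₁ * x + W.a₃ ≠ 0 := fun h0 => hy (by
        rw [negY]
        linear_combination h0)
      refine ⟨((2 * y + W.a₁ * x + W.a₃) ^ 2)⁻¹, inv_ne_zero (pow_ne_zero 2 hψ), ?_⟩
      rw [Point.add_self_of_Y_ne hy, Point.xRep_zero, Point.xRep_some, Point.xRep_some,
        slope_of_Y_ne rfl hy, addX, addSubVec_apply, eq_inv_smul_iff₀ (pow_ne_zero 2 hψ)]
      have hψ' : y - W.negY x y = 2 * y + W.a₁ * x + W.a₃ := by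
        rw [negY]
        ring
      rw [hψ']
      funext i
      fin_cases i
      · simp [symProd]
        field_simp
        simp only [b₄, b₆, b₈]
        grind
      · simp [symProd, b₂, b₄, b₆]
        linear_combination 4 * heq
      · simp [symProd]
        ring

/-- The sum and product of x(P + Q) and x(P - Q) are rational in those of x(P) and x(Q), with
denominator (x₁ - x₂)². Equal x-coordinates mean P = ±Q, which is duplication. -/
theorem symProd_xRep_add_sub [W.IsElliptic] (P Q : W.Point) : ∃ c : K, c ≠ 0 ∧
    symProd (P + Q).xRep (P - Q).xRep = c • addSubVec W (symProd P.xRep Q.xRep) := by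
  by_cases hPQ : P.xRep = Q.xRep
  · rw [hPQ]
    rcases Point.xRep_eq_xRep_iff.mp hPQ with rfl | rfl
    · simpa using symProd_xRep_add_self W P
    · obtain ⟨c, hc, h⟩ := symProd_xRep_add_self W Q
      refine ⟨c, hc, ?_⟩
      rw [← h, neg_add_cancel, ← neg_add', Point.xRep_neg, symProd_comm]
  rcases P with _ | ⟨x₁, y₁, h₁⟩
  · refine ⟨1, one_ne_zero, ?_⟩
    change symProd (0 + Q).xRep (0 - Q).xRep =
      (1 : K) • addSubVec W (symProd (0 : W.Point).xRep Q.xRep)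
    rw [zero_add, zero_sub, Point.xRep_neg]
    rcases Q with _ | ⟨x, y, h⟩
    · exact absurd rfl hPQ
    · rw [Point.xRep_zero, Point.xRep_some, addSubVec_apply]
      funext i
      fin_cases i <;> simp [symProd] <;> ring
  rcases Q with _ | ⟨x₂, y₂, h₂⟩
  · refine ⟨1, one_ne_zero, ?_⟩
    change symProd (Point.some x₁ y₁ h₁ + 0).xRep (Point.some x₁ y₁ h₁ - 0).xRep =
      (1 : K) • addSubVec W (symProd (Point.some x₁ y₁ h₁).xRep (0 : W.Point).xRep)
    rw [add_zero, sub_zero, Point.xRep_zero, Point.xRep_some, addSubVec_apply]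
    funext i
    fin_cases i <;> simp [symProd] <;> ring
  have hx : x₁ ≠ x₂ := by
    rintro rfl
    exact hPQ rfl
  have hx' : x₁ - x₂ ≠ 0 := sub_ne_zero.mpr hx
  have e₁ := (equation_iff _ _).mp h₁.1
  have e₂ := (equation_iff _ _).mp h₂.1
  refine ⟨((x₁ - x₂) ^ 2)⁻¹, inv_ne_zero (pow_ne_zero 2 hx'), ?_⟩
  rw [sub_eq_add_neg, Point.neg_some, Point.add_of_X_ne hx, Point.add_of_X_ne hx,
    Point.xRep_some, Point.xRep_some, Point.xRep_some, Point.xRep_some, slope_of_X_ne hx,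
    slope_of_X_ne hx, addX, addX, addSubVec_apply, eq_inv_smul_iff₀ (pow_ne_zero 2 hx'), negY]
  funext i
  fin_cases i
  · simp [symProd]
    field_simp
    simp only [b₄, b₆, b₈]
    grind
  · simp [symProd]
    field_simp
    simp only [b₂, b₄, b₆]
    grind
  · simp [symProd]
    ring

end Parallelogram

/-! ### The height of the coordinate `x` on a twist -/

section TwistHeight

open WeierstrassCurve WeierstrassCurve.Affine

variable {K : Type*} [Field K] {f : K[X]}

/-- Homogeneous coordinates of `X / d`, the coordinate `x` on `d y² = f(x)`. -/
def twistRep {d : K} (P : (twistModel f d).Point) : Fin 2 → K :=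
  ![P.xRep 0, d * P.xRep 1]

theorem twistRep_ne_zero {d : K} (hd : d ≠ 0) (P : (twistModel f d).Point) : twistRep P ≠ 0 := by
  intro h
  rcases P with _ | ⟨X, Y, hXY⟩
  · simpa [twistRep, Point.xRep] using congrFun h 0
  · exact hd (by simpa [twistRep, Point.xRep] using congrFun h 1)

/-- In the coordinate x = X / d the twist disappears from the map: the i-th coordinate identity is
multiplied by d^i, and these powers absorb those in b₂, …, b₈. This is the source of all uniformity
in d. -/
theorem symProd_twistRep_add_sub [DecidableEq K] {d : K} (h : IsEllipticTwist f d)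
    (P Q : (twistModel f d).Point) : ∃ c : K, c ≠ 0 ∧
    symProd (twistRep (P + Q)) (twistRep (P - Q)) =
      c • addSubVec (twistModel f 1) (symProd (twistRep P) (twistRep Q)) := by
  have : (twistModel f d).IsElliptic := ⟨isUnit_iff_ne_zero.mpr h.Δ_ne_zero⟩
  obtain ⟨c, hc, e⟩ := symProd_xRep_add_sub (twistModel f d) P Q
  refine ⟨c, hc, ?_⟩
  have e0 := congrFun e 0
  have e1 := congrFun e 1
  have e2 := congrFun e 2
  rw [addSubVec_apply] at e0 e1 e2 ⊢
  simp [symProd, twistModel, b₂, b₄, b₆, b₈] at e0 e1 e2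
  funext i
  fin_cases i
  · simp [symProd, twistRep, twistModel, b₂, b₄, b₆, b₈]
    linear_combination e0
  · simp [symProd, twistRep, twistModel, b₂, b₄, b₆, b₈]
    linear_combination d * e1
  · simp [symProd, twistRep, twistModel, b₂, b₄, b₆, b₈]
    linear_combination d ^ 2 * e2

variable [Height.AdmissibleAbsValues K]

/-- The height of the coordinate `x` of a point of `d y² = f(x)`. -/
def twistHeight {d : K} (P : (twistModel f d).Point) : ℝ := Height.logHeight (twistRep P)

theorem twistHeight_zero {d : K} : twistHeight (0 : (twistModel f d).Point) = 0 := by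
  have : twistRep (0 : (twistModel f d).Point) = ![1, 0] := by
    simp [twistRep, Point.xRep_zero]
  rw [twistHeight, this, Height.logHeight_swap, ← Height.logHeight₁_eq_logHeight,
    Height.logHeight₁_zero]

theorem twistHeight_some {d X Y : K} (h : (twistModel f d).Nonsingular X Y) :
    twistHeight (.some X Y h) = Height.logHeight₁ (X / d) := by
  rw [Height.logHeight₁_div_eq_logHeight]
  simp [twistHeight, twistRep, Point.xRep_some]

/-- The approximate parallelogram law, with an error term that is uniform in the twist. -/
theorem exists_abs_twistHeight_add_sub_le [DecidableEq K] (h : IsEllipticTwist f 1) :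
    ∃ C : ℝ, ∀ d : K, d ≠ 0 → ∀ P Q : (twistModel f d).Point,
      |twistHeight (P + Q) + twistHeight (P - Q) - 2 * twistHeight P - 2 * twistHeight Q| ≤ C := by
  have : (twistModel f 1).IsElliptic := ⟨isUnit_iff_ne_zero.mpr h.Δ_ne_zero⟩
  obtain ⟨C₁, hC₁⟩ := Height.abs_logHeight_sym2_sub_le K
  obtain ⟨C₂, hC₂⟩ := abs_logHeight_addSubMap_sub_two_mul_logHeight_le (twistModel f 1)
  have hsym : ∀ v w : Fin 2 → K, v ≠ 0 → w ≠ 0 →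
      |Height.logHeight (symProd v w) - (Height.logHeight v + Height.logHeight w)| ≤ C₁ := by
    intro v w hv hw
    have ev : v = ![v 0, v 1] := by ext i; fin_cases i <;> rfl
    have ew : w = ![w 0, w 1] := by ext i; fin_cases i <;> rfl
    rw [ev] at hv
    rw [ew] at hw
    have := hC₁ hv hw
    rwa [← ev, ← ew] at this
  -- `C₁` enters once for P ± Q and twice for P, Q, since the map is quadratic; `C₂` is the error of
  -- the map for d = 1.
  refine ⟨3 * C₁ + C₂, fun d hd P Q => ?_⟩
  have hd' : IsEllipticTwist f d := ⟨h.two_ne_zero, h.monic, h.natDegree_eq, h.discr_ne_zero, hd⟩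
  obtain ⟨c, hc, e⟩ := symProd_twistRep_add_sub hd' P Q
  have h₁ := hsym _ _ (twistRep_ne_zero hd (P + Q)) (twistRep_ne_zero hd (P - Q))
  have h₂ := hsym _ _ (twistRep_ne_zero hd P) (twistRep_ne_zero hd Q)
  have h₃ : |Height.logHeight (addSubVec (twistModel f 1) (symProd (twistRep P) (twistRep Q))) -
      2 * Height.logHeight (symProd (twistRep P) (twistRep Q))| ≤ C₂ := hC₂ _
  rw [e, Height.logHeight_smul_eq_logHeight _ hc] at h₁
  simp only [twistHeight]
  rw [abs_le] at h₁ h₂ h₃ ⊢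
  constructor <;> linarith [h₁.1, h₁.2, h₂.1, h₂.2, h₃.1, h₃.2]

end TwistHeight

/-! ### Canonical heights on abelian groups -/

/-- Tate's construction: a function that satisfies the parallelogram law up to a bounded error is
at a bounded distance from a function that is quadratic on multiples. -/
theorem exists_quadratic_of_abs_add_sub_le {G : Type*} [AddCommGroup G] {h : G → ℝ} {C : ℝ}
    (h0 : h 0 = 0) (hC : ∀ P Q, |h (P + Q) + h (P - Q) - 2 * h P - 2 * h Q| ≤ C) :
    ∃ g : G → ℝ, (∀ P, |h P - g P| ≤ C / 3) ∧ ∀ (n : ℕ) P, g (n • P) = n ^ 2 * g P := by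
  -- Equal arguments in `hC` give |h(2R) - 4h(R)| ≤ C; dividing by 4^(k+1) gives geometric decay.
  have hdist : ∀ P (k : ℕ), dist (h (2 ^ k • P) / 4 ^ k) (h (2 ^ (k + 1) • P) / 4 ^ (k + 1)) ≤
      C / 4 * (1 / 4) ^ k := by
    intro P k
    have := hC (2 ^ k • P) (2 ^ k • P)
    rw [sub_self, h0, ← two_nsmul, ← mul_nsmul', ← pow_succ'] at this
    rw [dist_comm, Real.dist_eq, show h (2 ^ (k + 1) • P) / 4 ^ (k + 1) - h (2 ^ k • P) / 4 ^ k =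
      (h (2 ^ (k + 1) • P) + 0 - 2 * h (2 ^ k • P) - 2 * h (2 ^ k • P)) / 4 ^ (k + 1) by
        field_simp; ring, abs_div, abs_of_pos (by positivity : (0 : ℝ) < 4 ^ (k + 1)),
      show C / 4 * (1 / 4) ^ k = C / 4 ^ (k + 1) by rw [one_div, inv_pow, pow_succ]; field_simp]
    gcongr
  have hlim : ∀ P, ∃ l, Tendsto (fun k : ℕ => h (2 ^ k • P) / 4 ^ k) atTop (𝓝 l) := fun P =>
    cauchySeq_tendsto_of_complete (cauchySeq_of_le_geometric _ _ (by norm_num) (hdist P))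
  choose g hg using hlim
  -- The error at 2^k P, 2^k Q is divided by 4^k, so the limit satisfies the law exactly.
  have hpar : ∀ P Q, g (P + Q) + g (P - Q) = 2 * g P + 2 * g Q := by
    intro P Q
    rw [← sub_eq_zero, ← abs_eq_zero]
    refine le_antisymm ?_ (abs_nonneg _)
    have hl : Tendsto (fun k : ℕ => |h (2 ^ k • (P + Q)) / 4 ^ k + h (2 ^ k • (P - Q)) / 4 ^ k -
        (2 * (h (2 ^ k • P) / 4 ^ k) + 2 * (h (2 ^ k • Q) / 4 ^ k))|) atTop
        (𝓝 |g (P + Q) + g (P - Q) - (2 * g P + 2 * g Q)|) :=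
      (((hg _).add (hg _)).sub (((hg P).const_mul 2).add ((hg Q).const_mul 2))).abs
    have hr : Tendsto (fun k : ℕ => C * (1 / 4 : ℝ) ^ k) atTop (𝓝 0) := by
      simpa using (tendsto_pow_atTop_nhds_zero_of_lt_one (by norm_num : (0 : ℝ) ≤ 1 / 4)
        (by norm_num)).const_mul C
    refine le_of_tendsto_of_tendsto' hl hr fun k => ?_
    have := hC (2 ^ k • P) (2 ^ k • Q)
    rw [← nsmul_add, ← nsmul_sub] at this
    rw [show h (2 ^ k • (P + Q)) / 4 ^ k + h (2 ^ k • (P - Q)) / 4 ^ k -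
        (2 * (h (2 ^ k • P) / 4 ^ k) + 2 * (h (2 ^ k • Q) / 4 ^ k)) =
        (h (2 ^ k • (P + Q)) + h (2 ^ k • (P - Q)) - 2 * h (2 ^ k • P) - 2 * h (2 ^ k • Q)) *
          (1 / 4) ^ k by rw [one_div, inv_pow]; ring, abs_mul,
      abs_of_pos (by positivity : (0 : ℝ) < (1 / 4) ^ k)]
    gcongr
  refine ⟨g, fun P => ?_, fun n P => ?_⟩
  · have := dist_le_of_le_geometric_of_tendsto₀ _ _ (by norm_num) (hdist P) (hg P)
    rw [Real.dist_eq] at this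
    simp only [pow_zero, one_nsmul, div_one] at this
    refine this.trans (le_of_eq ?_)
    ring
  · induction n using Nat.twoStepInduction with
    | zero =>
      have := hpar 0 0
      rw [add_zero, sub_zero] at this
      rw [zero_nsmul]
      push_cast
      linarith
    | one => simp
    | more n ih₁ ih₂ =>
      have := hpar ((n + 1) • P) P
      rw [← succ_nsmul, succ_nsmul P n, add_sub_cancel_right, ← succ_nsmul P n, ih₁, ih₂] at this
      push_cast at this ⊢
      linarith

/-- Existence of the limit that defines the canonical height. -/
theorem exists_tendsto_of_abs_add_sub_le {G : Type*} [AddCommGroup G] {h : G → ℝ} {C : ℝ}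
    (h0 : h 0 = 0) (hC : ∀ P Q, |h (P + Q) + h (P - Q) - 2 * h P - 2 * h Q| ≤ C) (P : G) :
    ∃ l, Tendsto (fun n : ℕ => h (n • P) / (2 * (n : ℝ) ^ 2)) atTop (𝓝 l) ∧
      h P / 2 - C / 6 ≤ l := by
  obtain ⟨g, hg, hquad⟩ := exists_quadratic_of_abs_add_sub_le h0 hC
  refine ⟨g P / 2, ?_, ?_⟩
  -- As g(nP) = n² g(P), the error C/3 divided by 2n² tends to 0.
  · have hz : Tendsto (fun n : ℕ => C / 6 * (((n : ℝ) ^ 2)⁻¹)) atTop (𝓝 0) := by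
      simpa using ((tendsto_pow_atTop (two_ne_zero)).comp
        tendsto_natCast_atTop_atTop).inv_tendsto_atTop.const_mul (C / 6)
    rw [tendsto_iff_dist_tendsto_zero]
    refine squeeze_zero' (Eventually.of_forall fun _ => dist_nonneg) ?_ hz
    filter_upwards [eventually_gt_atTop 0] with n hn
    have hn' : (0 : ℝ) < n := by exact_mod_cast hn
    have := hg (n • P)
    rw [hquad] at this
    rw [Real.dist_eq, show h (n • P) / (2 * (n : ℝ) ^ 2) - g P / 2 =
      (h (n • P) - n ^ 2 * g P) / (2 * (n : ℝ) ^ 2) by field_simp, abs_div,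
      abs_of_pos (by positivity : (0 : ℝ) < 2 * (n : ℝ) ^ 2), div_le_iff₀ (by positivity)]
    refine this.trans (le_of_eq ?_)
    field_simp
    ring
  · have := (abs_le.mp (hg P)).2
    linarith

/-! ### The canonical heights of a rational point and of its twist -/

theorem IsEllipticTwist.of_map {K M : Type*} [Field K] [Field M] (φ : K →+* M) {f : K[X]} {d : K}
    (h : IsEllipticTwist (f.map φ) (φ d)) : IsEllipticTwist f d := by
  have hm : f.Monic := monic_of_injective φ.injective h.monic
  have hn : f.natDegree = 3 := by rw [← natDegree_map φ, h.natDegree_eq]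
  refine ⟨fun h2 => h.two_ne_zero ?_, hm, hn, fun h0 => h.discr_ne_zero ?_, fun h0 => h.d_ne_zero ?_⟩
  · rw [← map_ofNat φ 2, h2, map_zero]
  · have e₁ : f.degree = 3 := by
      rw [degree_eq_natDegree hm.ne_zero, hn]; rfl
    have e₂ : (f.map φ).degree = 3 := by rw [degree_map, e₁]
    rw [discr_of_degree_eq_three e₁] at h0
    have := congrArg φ h0
    rw [discr_of_degree_eq_three e₂]
    simpa only [coeff_map, map_sub, map_add, map_mul, map_pow, map_ofNat, map_zero] using this
  · rw [h0, map_zero]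

section CanonicalHeight

variable {F : Type*} [Field F] {f : (RatFunc F)[X]} {d : RatFunc F}

open Classical in
-- Transport commutes with multiplication by n, and the transported coordinate is X / (u² d') = X /
-- d, independent of `u`. So the sequence can be computed over 𝔽_q(T).
theorem heightSeq_eq_of_equiv_eq_twistTransport [Finite F] {d' u : KBar F} (hu : u ≠ 0)
    (hd : u ^ 2 * d' = toKBar F d) (h : IsEllipticTwist (f.map (toKBar F)) d')
    {P : TwistPoint (f.map (toKBar F)) d'} {R : (twistModel f d).Point}
    (hR : h.equiv P = twistTransport (toKBar F) hu hd R) :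
    h.heightSeq P = fun n : ℕ => twistHeight (n • R) / (2 * (n : ℝ) ^ 2) := by
  funext n
  rw [IsEllipticTwist.heightSeq, IsEllipticTwist.mul, hR]
  congr 1
  have e : n • twistTransport (toKBar F) hu hd R = twistTransport (toKBar F) hu hd (n • R) :=
    (twistTransport_nsmul (toKBar F) hu hd n R).symm
  rw [e]
  rcases n • R with _ | ⟨X, Y, hXY⟩
  · exact twistHeight_zero.symm
  · rw [twistHeight_some, RatFunc.logHeight₁_eq_mapDegree]
    change logHeight (toKBar F X / u ^ 2 / d') = _
    rw [logHeight_of_pow_eq (m := 1) one_ne_zero (u := X / d), Nat.cast_one, div_one]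
    rw [pow_one, div_div, hd, map_div₀]

theorem equiv_pointOfK {f : F[X][X]} {d : F[X]}
    (h : IsEllipticTwist ((overK f).map (toKBar F)) (toKBar F (inK d)))
    {x y : RatFunc F} (hP : inK d * y ^ 2 = (overK f).eval x) :
    h.equiv (pointOfK x y hP) = twistTransport (toKBar F) one_ne_zero (by rw [one_pow, one_mul])
      ((IsEllipticTwist.of_map (toKBar F) h).equiv (.affine x y hP)) := by
  simp [pointOfK, TwistPoint.map, IsEllipticTwist.equiv, twistTransport]

/-- P and P' come from the same rational point of the model, with u = 1 in `equiv_pointOfK` and u =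
s here; hence their heights agree. -/
theorem equiv_untwist_pointOfK {f : F[X][X]} {d : F[X]}
    (h : IsEllipticTwist ((overK f).map (toKBar F)) (1 : KBar F))
    (hd : IsEllipticTwist (overK f) (inK d)) {s : KBar F} (hs : s ^ 2 = toKBar F (inK d))
    (hs0 : s ≠ 0) {x y : RatFunc F} (hP : inK d * y ^ 2 = (overK f).eval x) :
    h.equiv ((pointOfK x y hP).untwist s hs) = twistTransport (toKBar F) hs0
      (by rw [mul_one, hs]) (hd.equiv (.affine x y hP)) := by
  simp only [pointOfK, TwistPoint.map, TwistPoint.untwist, IsEllipticTwist.equiv, twistTransport,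
    Equiv.coe_fn_mk, WeierstrassCurve.Affine.Point.some.injEq, map_mul, map_pow]
  rw [← hs]
  constructor <;> field_simp

open Classical in
-- The constant is chosen before `d`, and the same limit serves both curves.
theorem exists_canonicalHeight_bound [Finite F] {f : F[X][X]} (h2 : ringChar F ≠ 2) (hf : f.Monic)
    (hdeg : f.natDegree = 3) (hdisc : f.discr ≠ 0) : ∃ C : ℝ, ∀ (d : F[X]) (hd : Squarefree d)
      (x y : RatFunc F) (hP : inK d * y ^ 2 = (overK f).eval x), ∃ l : ℝ,
      Tendsto ((twist_elliptic h2 hf hdeg hdisc hd).heightSeq (pointOfK x y hP)) atTop (𝓝 l) ∧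
      (∀ (s : KBar F) (hs : s ^ 2 = toKBar F (inK d)), Tendsto
        ((curve_elliptic h2 hf hdeg hdisc).heightSeq ((pointOfK x y hP).untwist s hs))
          atTop (𝓝 l)) ∧
      (x.mapDegree : ℝ) / 2 - C ≤ l := by
  have h₁ : IsEllipticTwist (overK f) 1 := by
    refine IsEllipticTwist.of_map (toKBar F) ?_
    rw [map_one]
    exact curve_elliptic h2 hf hdeg hdisc
  obtain ⟨C, hC⟩ := exists_abs_twistHeight_add_sub_le h₁
  refine ⟨C / 6, fun d hd x y hP => ?_⟩
  have hd₀ : inK d ≠ 0 := (map_ne_zero (toKBar F)).mp (inKBar_ne_zero hd)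
  have hK := IsEllipticTwist.of_map (toKBar F) (twist_elliptic h2 hf hdeg hdisc hd)
  obtain ⟨l, hl, hle⟩ := exists_tendsto_of_abs_add_sub_le twistHeight_zero (hC (inK d) hd₀)
    (hK.equiv (.affine x y hP))
  refine ⟨l, ?_, fun s hs => ?_, ?_⟩
  · rwa [heightSeq_eq_of_equiv_eq_twistTransport _ _ _ (equiv_pointOfK _ hP)]
  · have hs0 : s ≠ 0 := by
      rintro rfl
      exact inKBar_ne_zero hd (by rw [← hs, zero_pow two_ne_zero])
    rwa [heightSeq_eq_of_equiv_eq_twistTransport _ _ _ (equiv_untwist_pointOfK _ hK hs hs0 hP)]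
  · have e : twistHeight (hK.equiv (.affine x y hP)) = x.mapDegree := by
      change twistHeight (WeierstrassCurve.Affine.Point.some _ _ _) = _
      rw [twistHeight_some, RatFunc.logHeight₁_eq_mapDegree, mul_div_cancel_left₀ _ hd₀]
    rwa [e] at hle

end CanonicalHeight

/-! ### Degrees of rational functions -/

section Degrees

variable {F : Type*} [Field F]

theorem RatFunc.mapDegree_div_le (p : F[X]) {q : F[X]} (hq : q ≠ 0) :
    (algebraMap F[X] (RatFunc F) p / algebraMap F[X] (RatFunc F) q).mapDegree ≤
      max p.natDegree q.natDegree := by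
  rcases eq_or_ne p 0 with rfl | hp
  · simp [RatFunc.mapDegree]
  · exact max_le_max (natDegree_le_of_dvd (RatFunc.num_div_dvd p hq) hp)
      (natDegree_le_of_dvd (RatFunc.denom_div_dvd p q) hq)

theorem RatFunc.mapDegree_div_of_isCoprime {p q : F[X]} (hp : p ≠ 0) (hq : q ≠ 0)
    (h : IsCoprime p q) : (algebraMap F[X] (RatFunc F) p / algebraMap F[X] (RatFunc F) q).mapDegree =
      max p.natDegree q.natDegree := by
  refine le_antisymm (RatFunc.mapDegree_div_le p hq) ?_
  set z := algebraMap F[X] (RatFunc F) p / algebraMap F[X] (RatFunc F) q with hz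
  have e : z.num * q = p * z.denom := (RatFunc.num_mul_eq_mul_denom_iff hq).mpr hz
  have hz0 : z ≠ 0 := div_ne_zero (RatFunc.algebraMap_ne_zero hp) (RatFunc.algebraMap_ne_zero hq)
  exact max_le_max
    (natDegree_le_of_dvd (h.dvd_of_dvd_mul_right (Dvd.intro _ e.symm)) (RatFunc.num_ne_zero hz0))
    (natDegree_le_of_dvd (h.symm.dvd_of_dvd_mul_left (Dvd.intro_left _ e)) z.denom_ne_zero)

/-- The value of a monic polynomial at a rational function, written as a reduced fraction. -/
theorem exists_eval_eq_div_denom_pow {f : F[X][X]} (hf : f.Monic) : ∃ M : ℕ, ∀ x : RatFunc F,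
    ∃ A : F[X], IsCoprime A x.denom ∧ A.natDegree ≤ M + f.natDegree * x.mapDegree ∧
      (overK f).eval x = algebraMap F[X] (RatFunc F) A /
        algebraMap F[X] (RatFunc F) (x.denom ^ f.natDegree) := by
  set n := f.natDegree with hn
  refine ⟨(Finset.range (n + 1)).sup fun i => (f.coeff i).natDegree, fun x => ?_⟩
  -- The witness is b^n f(a/b) for x = a/b. Modulo b only a^n remains, `f` being monic, which gives
  -- coprimality.
  refine ⟨∑ i ∈ Finset.range (n + 1), f.coeff i * x.num ^ i * x.denom ^ (n - i), ?_, ?_, ?_⟩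
  · have hdvd : x.denom ∣ ∑ i ∈ Finset.range n, f.coeff i * x.num ^ i * x.denom ^ (n - i) :=
      Finset.dvd_sum fun i hi => Dvd.dvd.mul_left
        (dvd_pow_self _ (Nat.sub_pos_of_lt (Finset.mem_range.mp hi)).ne') _
    obtain ⟨r, hr⟩ := hdvd
    rw [Finset.sum_range_succ, hr, hf.coeff_natDegree, one_mul, Nat.sub_self, pow_zero, mul_one,
      add_comm]
    exact IsCoprime.add_mul_left_left x.isCoprime_num_denom.pow_left r
  · refine natDegree_sum_le_of_forall_le _ _ fun i hi => ?_
    have h₁ : (f.coeff i).natDegree ≤ (Finset.range (n + 1)).sup fun i => (f.coeff i).natDegree :=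
      Finset.le_sup (f := fun i => (f.coeff i).natDegree) hi
    have h₂ : (x.num ^ i).natDegree ≤ i * x.mapDegree :=
      natDegree_pow_le_of_le i (le_max_left _ _)
    have h₃ : (x.denom ^ (n - i)).natDegree ≤ (n - i) * x.mapDegree :=
      natDegree_pow_le_of_le _ (le_max_right _ _)
    have h₄ : i * x.mapDegree + (n - i) * x.mapDegree = n * x.mapDegree := by
      rw [← add_mul, Nat.add_sub_cancel' (Nat.lt_succ_iff.mp (Finset.mem_range.mp hi))]
    calc _ ≤ _ := natDegree_mul_le
      _ ≤ _ := add_le_add_left natDegree_mul_le _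
      _ ≤ _ := by omega
  · have hb : algebraMap F[X] (RatFunc F) x.denom ≠ 0 :=
      RatFunc.algebraMap_ne_zero x.denom_ne_zero
    rw [eval_eq_sum_range, hf.natDegree_map, ← hn, map_sum, Finset.sum_div]
    refine Finset.sum_congr rfl fun i hi => ?_
    have hi' : i ≤ n := Nat.lt_succ_iff.mp (Finset.mem_range.mp hi)
    conv_lhs => rw [← RatFunc.num_div_denom x]
    rw [coeff_map, map_mul, map_mul, map_pow, map_pow, map_pow, div_pow, ← mul_div_assoc,
      div_eq_div_iff (pow_ne_zero _ hb) (pow_ne_zero _ hb), mul_assoc _ (_ ^ (n - i)), ← pow_add,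
      Nat.sub_add_cancel hi']

/-- With e = gcd(d, v), both b^n and e v'² are denominators in lowest terms of the same fraction, so
they divide each other. The squarefree e then divides b, so e² divides b^n and hence e v'². -/
theorem exists_squarefree_factorization {A b d u v : F[X]} {n : ℕ} (hn : 2 ≤ n)
    (hA : IsCoprime A b) (huv : IsCoprime u v) (hd : Squarefree d) (hv : v ≠ 0)
    (h : A * v ^ 2 = d * u ^ 2 * b ^ n) : ∃ e d' v' : F[X], d = e * d' ∧ v = e * v' ∧
      IsCoprime (d' * u ^ 2) (e * v' ^ 2) ∧ e ∣ v' := by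
  classical
  obtain ⟨d', v', hd', hv', hu⟩ := extract_gcd d v
  set e := gcd d v
  have hco : IsCoprime d' v' := (gcd_isUnit_iff d' v').mp hu
  have he0 : e ≠ 0 := fun h0 => hv (by rw [hv', h0, zero_mul])
  have hde : IsCoprime d' e := by
    rw [hd', squarefree_mul_iff] at hd
    exact hd.1.symm.isCoprime
  rw [hv'] at huv
  have hcop : IsCoprime (d' * u ^ 2) (e * v' ^ 2) :=
    IsCoprime.mul_left (hde.mul_right hco.pow_right)
      ((huv.of_mul_right_left.mul_right huv.of_mul_right_right.pow_right).pow_left)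
  refine ⟨e, d', v', hd', hv', hcop, ?_⟩
  have hes : Squarefree e := hd.squarefree_of_dvd (Dvd.intro _ hd'.symm)
  have h' : A * (e * v' ^ 2) = d' * u ^ 2 * b ^ n := by
    apply mul_left_cancel₀ he0
    rw [hv'] at h
    rw [← mul_assoc (e : F[X]) (d' * u ^ 2), ← mul_assoc e d', ← hd', ← h]
    ring
  have h₁ : e * v' ^ 2 ∣ b ^ n := hcop.symm.dvd_of_dvd_mul_left (Dvd.intro_left _ h')
  have h₂ : b ^ n ∣ e * v' ^ 2 :=
    hA.symm.pow_left.dvd_of_dvd_mul_left (Dvd.intro_left _ h'.symm)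
  have h₃ : e ∣ b := (hes.dvd_pow_iff_dvd (by omega)).mp ((Dvd.intro _ rfl).trans h₁)
  have h₄ : e * e ∣ e * v' ^ 2 := by
    rw [← pow_two]
    exact ((pow_dvd_pow e hn).trans (pow_dvd_pow_of_dvd h₃ n)).trans h₂
  exact (hes.dvd_pow_iff_dvd two_ne_zero).mp ((mul_dvd_mul_iff_left he0).mp h₄)

/-- If N is the degree of d y², the numerator gives deg d' ≤ N and the denominator e v'², with e ∣
v', gives 3 deg e ≤ N; thus 3 (deg d' + deg e) ≤ 3N + N. -/
theorem three_mul_natDegree_le_four_mul_mapDegree {f : F[X][X]} (hf : f.Monic)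
    (hn : 2 ≤ f.natDegree) {d : F[X]} (hd : Squarefree d) {x y : RatFunc F}
    (hP : inK d * y ^ 2 = (overK f).eval x) (hy : y ≠ 0) :
    3 * d.natDegree ≤ 4 * (inK d * y ^ 2).mapDegree := by
  obtain ⟨M, hM⟩ := exists_eval_eq_div_denom_pow hf
  obtain ⟨A, hA, -, hx⟩ := hM x
  have hv := y.denom_ne_zero
  have hu := RatFunc.num_ne_zero hy
  have key : A * y.denom ^ 2 = d * y.num ^ 2 * x.denom ^ f.natDegree := by
    apply RatFunc.algebraMap_injective F
    rw [hx, ← RatFunc.num_div_denom y, div_pow, ← mul_div_assoc, div_eq_div_iff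
      (pow_ne_zero 2 (RatFunc.algebraMap_ne_zero hv))
      (RatFunc.algebraMap_ne_zero (pow_ne_zero _ x.denom_ne_zero))] at hP
    simp only [map_mul, map_pow] at hP ⊢
    exact hP.symm
  obtain ⟨e, d', v', hd', hv', hcop, hev⟩ :=
    exists_squarefree_factorization hn hA y.isCoprime_num_denom hd hv key
  have he : e ≠ 0 := fun h => hv (by rw [hv', h, zero_mul])
  have hv0 : v' ≠ 0 := fun h => hv (by rw [hv', h, mul_zero])
  have hd0 : d' ≠ 0 := fun h => hd.ne_zero (by rw [hd', h, mul_zero])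
  have hz : inK d * y ^ 2 = algebraMap F[X] (RatFunc F) (d' * y.num ^ 2) /
      algebraMap F[X] (RatFunc F) (e * v' ^ 2) := by
    have he' := RatFunc.algebraMap_ne_zero he
    have hv0' := RatFunc.algebraMap_ne_zero hv0
    conv_lhs => rw [← RatFunc.num_div_denom y, hv', inK, hd']
    simp only [map_mul, map_pow]
    field_simp
  rw [hz, RatFunc.mapDegree_div_of_isCoprime (mul_ne_zero hd0 (pow_ne_zero 2 hu))
    (mul_ne_zero he (pow_ne_zero 2 hv0)) hcop, natDegree_mul hd0 (pow_ne_zero 2 hu),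
    natDegree_mul he (pow_ne_zero 2 hv0), natDegree_pow, natDegree_pow]
  have h₁ : d.natDegree = e.natDegree + d'.natDegree := by rw [hd', natDegree_mul he hd0]
  have h₂ := natDegree_le_of_dvd hev hv0
  omega

theorem mapDegree_eval_le {f : F[X][X]} (hf : f.Monic) : ∃ M : ℕ, ∀ x : RatFunc F,
    ((overK f).eval x).mapDegree ≤ M + f.natDegree * x.mapDegree := by
  obtain ⟨M, hM⟩ := exists_eval_eq_div_denom_pow hf
  refine ⟨M, fun x => ?_⟩
  obtain ⟨A, -, hA, hx⟩ := hM x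
  rw [hx]
  refine (RatFunc.mapDegree_div_le A (pow_ne_zero _ x.denom_ne_zero)).trans (max_le hA ?_)
  refine (natDegree_pow_le_of_le _ (le_max_right _ _)).trans (Nat.le_add_left _ _)

end Degrees

end

/-! ### The three statements on heights of twists -/

theorem mainTheorem8 (F : Type*) [Field F] [Finite F] (f : F[X][X]) (hf : f.Monic)
    (hdisc : f.discr ≠ 0) :
    -- the canonical height is preserved (and the limits that define it exist)
    (∀ (h2 : ringChar F ≠ 2) (hdeg : f.natDegree = 3) (d : F[X]) (hd : Squarefree d)
      (x y : RatFunc F) (hP : inK d * y ^ 2 = (overK f).eval x)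
      (s : KBar F) (hs : s ^ 2 = toKBar F (inK d)),
      Tendsto ((twist_elliptic h2 hf hdeg hdisc hd).heightSeq (pointOfK x y hP)) atTop
        (𝓝 ((twist_elliptic h2 hf hdeg hdisc hd).canonicalHeight (pointOfK x y hP))) ∧
      Tendsto ((curve_elliptic h2 hf hdeg hdisc).heightSeq ((pointOfK x y hP).untwist s hs)) atTop
        (𝓝 ((curve_elliptic h2 hf hdeg hdisc).canonicalHeight
          ((pointOfK x y hP).untwist s hs))) ∧
      (twist_elliptic h2 hf hdeg hdisc hd).canonicalHeight (pointOfK x y hP) =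
        (curve_elliptic h2 hf hdeg hdisc).canonicalHeight ((pointOfK x y hP).untwist s hs)) ∧
    -- the lower bound for `h_y`
    (2 ≤ f.natDegree → ∀ (d : F[X]), Squarefree d →
      ∀ (x y : RatFunc F) (hP : inK d * y ^ 2 = (overK f).eval x)
      (s : KBar F) (hs : s ^ 2 = toKBar F (inK d)), y ≠ 0 →
      ((pointOfK x y hP).untwist s hs).heightY ≥ 3 / 8 * (d.natDegree : ℝ)) ∧
    -- the lower bound for the canonical height
    (∀ (h2 : ringChar F ≠ 2) (hdeg : f.natDegree = 3), ∃ c : ℝ,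
      ∀ (d : F[X]) (hd : Squarefree d)
      (x y : RatFunc F) (hP : inK d * y ^ 2 = (overK f).eval x), y ≠ 0 →
      (twist_elliptic h2 hf hdeg hdisc hd).canonicalHeight (pointOfK x y hP) ≥
        1 / 8 * (d.natDegree : ℝ) + c) := by
  refine ⟨fun h2 hdeg d hd x y hP s hs => ?_, fun hn d hd x y hP s hs hy => ?_, fun h2 hdeg => ?_⟩
  · obtain ⟨C, hC⟩ := exists_canonicalHeight_bound h2 hf hdeg hdisc
    obtain ⟨l, hl, hl', -⟩ := hC d hd x y hP
    have e : (twist_elliptic h2 hf hdeg hdisc hd).canonicalHeight (pointOfK x y hP) = l :=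
      hl.limUnder_eq
    have e' : (curve_elliptic h2 hf hdeg hdisc).canonicalHeight ((pointOfK x y hP).untwist s hs) =
        l := (hl' s hs).limUnder_eq
    rw [e, e']
    exact ⟨hl, hl' s hs, rfl⟩
  · have hz : (s * toKBar F y) ^ 2 = toKBar F (inK d * y ^ 2) := by
      rw [mul_pow, hs, map_mul, map_pow]
    change logHeight (s * toKBar F y) ≥ _
    rw [logHeight_of_pow_eq two_ne_zero hz]
    have : (3 * d.natDegree : ℝ) ≤ 4 * (inK d * y ^ 2).mapDegree := by
      exact_mod_cast three_mul_natDegree_le_four_mul_mapDegree hf hn hd hP hy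
    push_cast
    linarith
  · obtain ⟨C, hC⟩ := exists_canonicalHeight_bound h2 hf hdeg hdisc
    obtain ⟨M, hM⟩ := mapDegree_eval_le hf
    -- From (3/4) deg d ≤ M + 3 deg x one gets (deg x)/2 ≥ (deg d)/8 - M/6; passing to the canonical
    -- height costs `C`.
    refine ⟨-(M / 6 + C), fun d hd x y hP hy => ?_⟩
    obtain ⟨l, hl, -, hle⟩ := hC d hd x y hP
    have e : (twist_elliptic h2 hf hdeg hdisc hd).canonicalHeight (pointOfK x y hP) = l :=
      hl.limUnder_eq
    rw [e]
    have h₁ : (3 * d.natDegree : ℝ) ≤ 4 * ((overK f).eval x).mapDegree := by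
      rw [← hP]
      exact_mod_cast three_mul_natDegree_le_four_mul_mapDegree hf (by omega) hd hP hy
    have h₂ : (((overK f).eval x).mapDegree : ℝ) ≤ M + 3 * x.mapDegree := by
      exact_mod_cast hdeg ▸ hM x
    linarith
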